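/- Let $q$ be a prime power, let $0\le h<k$ be integers and put $n=4k+h$. For $i=1,2,3$ let $\mathbf P_i$ be the companion matrix (with rows $e_2,\dots,e_{ik+h},(-a_0,\dots,-a_{ik+h-1})$) of a primitive polynomial $x^{ik+h}+a_{ik+h-1}x^{ik+h-1}+\dots+a_0$ of degree $ik+h$ over $\mathbb F_q$, and let $$G_i=\left\langle \mathrm{diag}(\mathbf I_{(3-i)k},\mathbf I_k,\mathbf P_i)\right\rangle\le \mathrm{GL}_n(\mathbb F_q).$$ For a matrix $\mathbf U$ write $\mathbf U^{(j)}$ for the matrix of its first $j$ rows, $\mathbf U^{[j]}$ for $\mathbf U$ without its first $j$ rows, and $\mathrm{rs}(\mathbf U)$ for its row space. Define the $(n-1)\times n$ matrices $$\mathbf A_i=\begin{bmatrix}\mathbf 0&\mathbf I_k&\mathbf I_{ik+h}^{(k)}\\ \mathbf 0&\mathbf 0&\mathbf I_{ik+h}^{[k]}\\ \mathbf I_{(3-i)k}&\mathbf 0&\mathbf 0\\ \mathbf 0&\mathbf 0&\mathbf I_{ik+h}^{(k-1)}\end{bmatrix},\qquad \mathbf B_i=\begin{bmatrix}\mathbf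 0&\mathbf I_k&\mathbf 0\\ \mathbf 0&\mathbf 0&\mathbf I_{ik+h}^{[k]}\\ \mathbf I_{(3-i)k}&\mathbf 0&\mathbf 0\\ \mathbf 0&\mathbf 0&\mathbf I_{ik+h}^{(k-1)}\end{bmatrix},$$ and let $\mathbf M$ be the $(n-1)\times n$ matrix with rows $e_n,e_{n-1},\dots,e_2$. Let $\mathcal W=\{\mathbf A_ig,\ \mathbf B_i,\ \mathbf M: g\in G_i,\ 1\le i\le 3\}$ and put $$\mathscr C=\{\mathrm{rs}(\mathbf W):\mathbf W\in\mathcal W\},\qquad \mathcal C=\{(\mathrm{rs}(\mathbf W^{(1)}),\dots,\mathrm{rs}(\mathbf W^{(n-1)})):\mathbf W\in\mathcal W\}.$$ Let $\mathbf t=(t_1,\dots,t_r)=(1,2,\dots,k+h,\,2k+h,\,3k+h,\dots,n-1)$, for $\mathbf W\in\mathcal W$ put $\mathrm W^{(\mathbf t)}=(\mathrm{rs}(\mathbf W^{(t_1)}),\dots,\mathrm{rs}(\mathbf W^{(t_r)}))$, and let $\mathcal C_{\mathbf t}=\{\mathrm W^{(\mathbf t)}:\mathbf W\in\mathcal W\}$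 be the truncation of $\mathcal C$ to the type $\mathbf t$. For a flag code of type $\mathbf t$, the $j$-th projected code is the set of the $j$-th components of its flags, the code is called cardinality-consistent if each of its projected codes has the same cardinality as the code, and its minimum distance $d_f$ is the minimum over pairs of distinct flags of $d_f(\mathcal F,\mathcal F')=\sum_{j=1}^r\big(\dim(\mathrm F_j+\mathrm F'_j)-\dim(\mathrm F_j\cap \mathrm F'_j)\big)$. Then $\mathcal C_{\mathbf t}$ is a code of flags of type $\mathbf t$ on $\mathbb F_q^n$ with $$|\mathcal C_{\mathbf t}|=|\mathcal C|=|\mathscr C|=\sum_{i=1}^{3}q^{ik+h}+1 \qquad\text{and}\qquad d_f(\mathcal C_{\mathbf t})=2k(k+h+1)+2h,$$ and the minimum distance is attained by the pair $\mathrm B_1^{(\mathbf t)},\mathrm B_3^{(\mathbf t)}$ of the flags of $\mathbf B_1$ and $\mathbf B_3$. For every $j$ with $t_j\ne 2k+h$ the $j$-th projected code of $\mathcal C_{\mathbf t}$ has cardinality $|\mathcal C_{\mathbf t}|$, and $\mathcal C_{\mathbf t}$ is cardinality-consistent if and only if $h\ge 1$. -/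

import Mathlib

namespace FlagCode

/-! Subspaces of `K ^ n`, flags and flag codes. -/

section General

variable {K : Type*} [Field K] {n r : ℕ}

/-- The subspace distance `dim (U + V) - dim (U ∩ V)`.  The subtraction does not truncate,
because `U ∩ V` is contained in `U + V`. -/
noncomputable def subspaceDist (U V : Submodule K (Fin n → K)) : ℕ :=
  Module.finrank K (U ⊔ V : Submodule K (Fin n → K)) -
    Module.finrank K (U ⊓ V : Submodule K (Fin n → K))

/-- `IsFlag t F`: the sequence `F = (F_1, ..., F_r)` is a flag of type `t = (t_1, ..., t_r)`
on `K ^ n`. -/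
structure IsFlag (t : Fin r → ℕ) (F : Fin r → Submodule K (Fin n → K)) : Prop where
  strictMono : StrictMono F
  bot_lt : ∀ i, ⊥ < F i
  lt_top : ∀ i, F i < ⊤
  finrank_eq : ∀ i, Module.finrank K (F i) = t i

/-- The flag distance, the sum of the subspace distances of the components. -/
noncomputable def flagDist (F F' : Fin r → Submodule K (Fin n → K)) : ℕ :=
  ∑ i, subspaceDist (F i) (F' i)

/-- `d` is the minimum distance of the flag code `C`, that is, the minimum of the distances of
two distinct flags in `C` (and there are two such flags). -/
def IsMinDist (C : Set (Fin r → Submodule K (Fin n → K))) (d : ℕ) : Prop :=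
  IsLeast {e | ∃ F ∈ C, ∃ F' ∈ C, F ≠ F' ∧ e = flagDist F F'} d

/-- The `i`-th projected code of a flag code. -/
def projectedCode (C : Set (Fin r → Submodule K (Fin n → K))) (i : Fin r) :
    Set (Submodule K (Fin n → K)) :=
  (fun F => F i) '' C

/-- All projected codes have the same cardinality as the code itself. -/
def CardinalityConsistent (C : Set (Fin r → Submodule K (Fin n → K))) : Prop :=
  ∀ i, (projectedCode C i).ncard = C.ncard

/-- The row space of a matrix. -/
def rowSpace {m : ℕ} (W : Matrix (Fin m) (Fin n) K) : Submodule K (Fin n → K) :=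
  Submodule.span K (Set.range W.row)

/-- `W ^ (j)`, the space spanned by the first `j` rows of `W`. -/
def firstRowsSpace {m : ℕ} (W : Matrix (Fin m) (Fin n) K) (j : ℕ) :
    Submodule K (Fin n → K) :=
  Submodule.span K (W.row '' {a | (a : ℕ) < j})

/-- `W ^ (t) = (W ^ (t_1), ..., W ^ (t_r))`. -/
def rowsFlag {m : ℕ} (t : Fin r → ℕ) (W : Matrix (Fin m) (Fin n) K) :
    Fin r → Submodule K (Fin n → K) :=
  fun i => firstRowsSpace W (t i)

end General

/-! The construction on `K ^ n` with `n = s k + h`. -/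

section Construction

variable {K : Type*} [Field K]

/-- `f` is a primitive polynomial of degree `m` over the finite field `K`: it is monic and
irreducible of degree `m`, and its roots generate the multiplicative group of the field with
`|K| ^ m` elements. -/
def IsPrimitivePolynomial (f : Polynomial K) (m : ℕ) : Prop :=
  f.Monic ∧ Irreducible f ∧ f.natDegree = m ∧ orderOf (AdjoinRoot.root f) = Nat.card K ^ m - 1

/-- The companion matrix of a polynomial `f = x ^ m + a_{m-1} x ^ (m-1) + ... + a_0`:
the rows are the second to the last standard unit vectors, and then
`(-a_0, -a_1, ..., -a_{m-1})`. -/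
def companion (f : Polynomial K) (m : ℕ) : Matrix (Fin m) (Fin m) K :=
  Matrix.of fun a b =>
    if (a : ℕ) + 1 < m then (if (b : ℕ) = a + 1 then 1 else 0) else -f.coeff b

theorem dim_split (s k h i : ℕ) (hi : i < s) :
    ((s - i - 1) * k + k) + (i * k + h) = s * k + h := by
  obtain ⟨j, rfl⟩ := Nat.exists_eq_add_of_lt hi
  have : i + j + 1 - i - 1 = j := by omega
  rw [this]
  ring

/-- The block diagonal matrix with diagonal blocks `I_{(s-i-1)k}`, `I_k` (together one identity
matrix of size `(s-i-1)k + k`) and `X`. -/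
def blockDiag (s k h i : ℕ) (hi : i < s) (X : Matrix (Fin (i * k + h)) (Fin (i * k + h)) K) :
    Matrix (Fin (s * k + h)) (Fin (s * k + h)) K :=
  Matrix.reindex (finSumFinEquiv.trans (finCongr (dim_split s k h i hi)))
    (finSumFinEquiv.trans (finCongr (dim_split s k h i hi)))
    (Matrix.fromBlocks (1 : Matrix (Fin ((s - i - 1) * k + k)) (Fin ((s - i - 1) * k + k)) K)
      0 0 X)

/-- The cyclic group `G_i`, the subgroup of `GL_n` generated by the block diagonal matrix
`diag (I_{(s-i-1)k}, I_k, P_i)`, where `P_i` is the companion matrix of `f`. -/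
def groupG (s k h i : ℕ) (hi : i < s) (f : Polynomial K) :
    Subgroup (GL (Fin (s * k + h)) K) :=
  Subgroup.closure
    {g | (g : Matrix (Fin (s * k + h)) (Fin (s * k + h)) K) =
      blockDiag s k h i hi (companion f (i * k + h))}

/-- The matrix `A_i`, of size `(n - 1) × n`.  With `d = i k + h` and `z = (s - i - 1) k`, the
columns are divided into blocks of widths `z`, `k`, `d`, the rows into blocks of heights `k`,
`d - k`, `z`, `k - 1`, and the matrix is

`[ 0    I_k  (first k rows of I_d)     ]`
`[ 0    0    (last d - k rows of I_d)  ]`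
`[ I_z  0    0                         ]`
`[ 0    0    (first k - 1 rows of I_d) ]`. -/
def matA (K : Type*) [Field K] (s k h i : ℕ) :
    Matrix (Fin (s * k + h - 1)) (Fin (s * k + h)) K :=
  let d := i * k + h
  let z := (s - i - 1) * k
  Matrix.of fun a b =>
    if (a : ℕ) < k then (if (b : ℕ) = z + a ∨ (b : ℕ) = z + k + a then 1 else 0)
    else if (a : ℕ) < d then (if (b : ℕ) = z + k + a then 1 else 0)
    else if (a : ℕ) < d + z then (if (b : ℕ) = a - d then 1 else 0)
    else (if (b : ℕ) = z + k + (a - (d + z)) then 1 else 0)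

/-- The matrix `B_i`, of size `(n - 1) × n`, with the same division into blocks as `A_i`:

`[ 0    I_k  0                         ]`
`[ 0    0    (last d - k rows of I_d)  ]`
`[ I_z  0    0                         ]`
`[ 0    0    (first k - 1 rows of I_d) ]`. -/
def matB (K : Type*) [Field K] (s k h i : ℕ) :
    Matrix (Fin (s * k + h - 1)) (Fin (s * k + h)) K :=
  let d := i * k + h
  let z := (s - i - 1) * k
  Matrix.of fun a b =>
    if (a : ℕ) < k then (if (b : ℕ) = z + a then 1 else 0)
    else if (a : ℕ) < d then (if (b : ℕ) = z + k + a then 1 else 0)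
    else if (a : ℕ) < d + z then (if (b : ℕ) = a - d then 1 else 0)
    else (if (b : ℕ) = z + k + (a - (d + z)) then 1 else 0)

/-- The matrix `M`, of size `(n - 1) × n`, whose rows are the last, the last but one, ..., the
second standard unit vector. -/
def matM (K : Type*) [Field K] (s k h : ℕ) :
    Matrix (Fin (s * k + h - 1)) (Fin (s * k + h)) K :=
  Matrix.of fun a b => if (b : ℕ) + a + 1 = s * k + h then 1 else 0

/-- The matrices `A_i g`, `B_i` and `M`, for `1 ≤ i ≤ s - 1` and `g ∈ G_i`, where `P_i` is the
companion matrix of `f i`. -/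
def generatorMatrices (s k h : ℕ) (f : ℕ → Polynomial K) :
    Set (Matrix (Fin (s * k + h - 1)) (Fin (s * k + h)) K) :=
  {W | (∃ i, 1 ≤ i ∧ ∃ hi : i < s, ∃ g ∈ groupG s k h i hi (f i),
          W = matA K s k h i * (g : Matrix (Fin (s * k + h)) (Fin (s * k + h)) K)) ∨
       (∃ i, 1 ≤ i ∧ i < s ∧ W = matB K s k h i) ∨
       W = matM K s k h}

/-- The subspace code of all row spaces of the generator matrices. -/
def subspaceCode (s k h : ℕ) (f : ℕ → Polynomial K) :
    Set (Submodule K (Fin (s * k + h) → K)) :=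
  rowSpace '' generatorMatrices s k h f

/-- The flag code of type `t` given by the generator matrices. -/
def flagCode (s k h : ℕ) (f : ℕ → Polynomial K) {r : ℕ} (t : Fin r → ℕ) :
    Set (Fin r → Submodule K (Fin (s * k + h) → K)) :=
  rowsFlag t '' generatorMatrices s k h f

/-- The type `(1, 2, ..., n - 1)` of full flags. -/
def fullType (n : ℕ) : Fin (n - 1) → ℕ := fun j => j + 1

/-- The full flag code. -/
def fullFlagCode (s k h : ℕ) (f : ℕ → Polynomial K) :
    Set (Fin (s * k + h - 1) → Submodule K (Fin (s * k + h) → K)) :=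
  flagCode s k h f (fullType (s * k + h))

/-- The type `(1, 2, ..., k + h, 2 k + h, 3 k + h, 3 k + h + 1, ..., 4 k + h - 1)`, of length
`(k + h) + 1 + k`. -/
def longType (k h : ℕ) : Fin (k + h + 1 + k) → ℕ := fun j =>
  if (j : ℕ) < k + h then j + 1
  else if (j : ℕ) = k + h then 2 * k + h
  else 3 * k + h + (j - (k + h + 1))

/-- The truncation of the full flag code to a type whose entries lie between `1` and `n - 1`
picks the components of these dimensions. -/
theorem flagCode_eq_truncation (s k h : ℕ) (f : ℕ → Polynomial K) {r : ℕ} (t : Fin r → ℕ)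
    (ht : ∀ i, 1 ≤ t i ∧ t i < s * k + h) :
    flagCode s k h f t =
      (fun F i => F ⟨t i - 1, by have := ht i; omega⟩) '' fullFlagCode s k h f := by
  rw [fullFlagCode, flagCode, flagCode, Set.image_image]
  refine Set.image_congr fun W _ => funext fun i => ?_
  have h1 : t i - 1 + 1 = t i := Nat.sub_add_cancel (ht i).1
  simp only [rowsFlag, fullType, h1]

end Construction

end FlagCode

/-! Write d = ik+h, z = (3-i)k, and let α be the class of x in the field E_i = K[x]/(f_i). Reading
the last d coordinates of a row vector as the coefficients of an element of E_i, the unit vectors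
become 1, α, ..., α^(d-1), and multiplication by the companion matrix becomes multiplication by α.
Since f_i is primitive, the elements of G_i act exactly as the nonzero elements of E_i. So A_i g has
head rows e_{z+a} + [α^a x] and further rows [α^a x] with x ≠ 0, while B_i is the case x = 0 with x
replaced by 1 outside the head. The codewords are thus labelled by M and the pairs (i, x) with x in
E_i, which gives the count once the labelling is injective (`generatorMatrices_eq_range`,
`card_label`, `labelSpan_injective`).

Every matrix has independent rows, so two components of dimension t have distance 2(dim of their sum
- t). Everything reduces to bounding sums from below, mostly by `finrank_add_card_le`: exhibit a
subspace of the sum vanishing on some columns, and vectors of the sum realising unit vectors on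
those columns. For distinct codewords the sum has dimension at least t + min(t,k) if t ≤ k+h, at
least 2k+2h if t = 2k+h, and it is the whole space if t ≥ 3k+h (`minSupDim_le_labelSpan`). Adding
these bounds over the type gives the claimed distance. The first components already separate
codewords.

The weak dimension is t = 2k+h, where only the pair B_1, B_3 can fall below 3k+h. Both matrices
consist of unit vectors, and counting indices shows that this pair meets the bound in every
component (`finrank_sup_labelSpan_zero`). The excess at t = 2k+h is h, so for h = 0 these two flags
share that component, and for h ≥ 1 all components separate codewords. -/

namespace FlagCode

/-! ### Dimension counts by coordinates, and spans of initial rows -/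

section CoordinateTools

variable {K : Type*} [Field K] {n : ℕ}

/-- The standard unit vector with a `1` at position `b`, where `b` is a natural number. -/
def unitVec (K : Type*) [Field K] (n b : ℕ) : Fin n → K := fun c => if (c : ℕ) = b then 1 else 0

theorem unitVec_eq_single (b : Fin n) : unitVec K n b = Pi.single b 1 := by
  ext c
  simp [unitVec, Pi.single_apply, Fin.ext_iff]

theorem eq_top_of_unitVec_mem {W : Submodule K (Fin n → K)}
    (h : ∀ b < n, unitVec K n b ∈ W) : W = ⊤ := by
  rw [eq_top_iff, ← (Pi.basisFun K (Fin n)).span_eq, Submodule.span_le]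
  rintro _ ⟨b, rfl⟩
  simpa [unitVec_eq_single] using h b b.2

/-- A subspace `W` whose restriction to the coordinates in `B` is onto, and which contains a
subspace `S` vanishing on `B`, has dimension at least `dim S + |B|`. -/
theorem finrank_add_card_le {S W : Submodule K (Fin n → K)} (B : Finset ℕ) (hSW : S ≤ W)
    (hBn : ∀ b ∈ B, b < n) (hS : ∀ v ∈ S, ∀ c : Fin n, (c : ℕ) ∈ B → v c = 0)
    (hW : ∀ b ∈ B, ∃ w ∈ W, ∀ c : Fin n, (c : ℕ) ∈ B → w c = if (c : ℕ) = b then 1 else 0) :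
    Module.finrank K S + B.card ≤ Module.finrank K W := by
  let p : (Fin n → K) →ₗ[K] (B → K) := LinearMap.funLeft K K fun b => ⟨b.1, hBn b.1 b.2⟩
  let q : W →ₗ[K] (B → K) := p.domRestrict W
  have hq : LinearMap.range q = ⊤ := by
    rw [eq_top_iff, ← (Pi.basisFun K B).span_eq, Submodule.span_le]
    rintro _ ⟨b, rfl⟩
    obtain ⟨w, hw, hwB⟩ := hW b.1 b.2
    refine ⟨⟨w, hw⟩, ?_⟩
    ext c
    have := hwB ⟨c.1, hBn c.1 c.2⟩ c.2
    simp only [q, p, LinearMap.domRestrict_apply, LinearMap.funLeft_apply, this,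
      Pi.basisFun_apply, Pi.single_apply, Subtype.ext_iff]
  have h1 := q.finrank_range_add_finrank_ker
  rw [hq, finrank_top, Module.finrank_fintype_fun_eq_card, Fintype.card_coe] at h1
  have h2 : Module.finrank K S ≤ Module.finrank K (LinearMap.ker q) := by
    let g : S →ₗ[K] LinearMap.ker q := (Submodule.inclusion hSW).codRestrict (LinearMap.ker q)
      fun v => by
        ext b
        exact hS v.1 v.2 ⟨b.1, hBn b.1 b.2⟩ b.2
    refine LinearMap.finrank_le_finrank_of_injective (f := g) fun v w hvw => ?_
    have := congrArg (fun u : LinearMap.ker q => ((u : W) : Fin n → K)) hvw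
    exact Subtype.ext this
  omega

/-- The span of the first `t` members of a sequence of vectors. -/
def rowsSpan (row : ℕ → Fin n → K) (t : ℕ) : Submodule K (Fin n → K) :=
  Submodule.span K (row '' Set.Iio t)

theorem row_mem_rowsSpan (row : ℕ → Fin n → K) {a t : ℕ} (h : a < t) :
    row a ∈ rowsSpan row t :=
  Submodule.subset_span ⟨a, h, rfl⟩

theorem rowsSpan_le {row : ℕ → Fin n → K} {t : ℕ} {W : Submodule K (Fin n → K)}
    (h : ∀ a < t, row a ∈ W) : rowsSpan row t ≤ W := by
  rw [rowsSpan, Submodule.span_le]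
  rintro _ ⟨a, ha, rfl⟩
  exact h a ha

theorem rowsSpan_mono (row : ℕ → Fin n → K) {s t : ℕ} (h : s ≤ t) :
    rowsSpan row s ≤ rowsSpan row t :=
  rowsSpan_le fun _ ha => row_mem_rowsSpan row (ha.trans_le h)

theorem rowsSpan_apply_eq_zero {row : ℕ → Fin n → K} {t : ℕ} {c : Fin n}
    (h : ∀ a < t, row a c = 0) : ∀ v ∈ rowsSpan row t, v c = 0 := by
  have : rowsSpan row t ≤ LinearMap.ker (LinearMap.proj (R := K) (φ := fun _ : Fin n => K) c) :=
    rowsSpan_le fun a ha => by simpa using h a ha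
  exact fun v hv => by simpa using this hv

theorem rowsSpan_eq_span_range (row : ℕ → Fin n → K) (t : ℕ) :
    rowsSpan row t = Submodule.span K (Set.range fun a : Fin t => row a) := by
  rw [rowsSpan]
  congr 1
  ext v
  constructor
  · rintro ⟨a, ha, rfl⟩
    exact ⟨⟨a, ha⟩, rfl⟩
  · rintro ⟨a, rfl⟩
    exact ⟨a, a.2, rfl⟩

theorem finrank_rowsSpan_of_linearIndependent {row : ℕ → Fin n → K} {t : ℕ}
    (h : LinearIndependent K fun a : Fin t => row a) :
    Module.finrank K (rowsSpan row t) = t := by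
  rw [rowsSpan_eq_span_range, finrank_span_eq_card h, Fintype.card_fin]

/-- Independence passes to prefixes, so one count for the full system of rows settles the dimensions
of all components of a flag. -/
theorem finrank_rowsSpan {row : ℕ → Fin n → K} {m t : ℕ}
    (h : m ≤ Module.finrank K (rowsSpan row m)) (ht : t ≤ m) :
    Module.finrank K (rowsSpan row t) = t := by
  apply finrank_rowsSpan_of_linearIndependent
  have : LinearIndependent K fun a : Fin m => row a := by
    rw [linearIndependent_iff_card_le_finrank_span, Fintype.card_fin, Set.finrank,
      ← rowsSpan_eq_span_range]
    exact h
  exact this.comp (Fin.castLE ht) (Fin.castLE_injective ht)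

theorem le_finrank_of_sup_span_singleton_eq_top {U : Submodule K (Fin n → K)} {v : Fin n → K}
    (h : U ⊔ Submodule.span K {v} = ⊤) : n - 1 ≤ Module.finrank K U := by
  have h1 := Submodule.finrank_add_le_finrank_add_finrank U (Submodule.span K {v})
  rw [h, finrank_top, Module.finrank_fin_fun] at h1
  have h2 := finrank_span_le_card (R := K) ({v} : Set (Fin n → K))
  rw [Set.toFinset_singleton, Finset.card_singleton] at h2
  omega

theorem firstRowsSpace_of {m : ℕ} (row : ℕ → Fin n → K) {t : ℕ} (ht : t ≤ m) :
    firstRowsSpace (Matrix.of fun a : Fin m => row a) t = rowsSpan row t := by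
  rw [firstRowsSpace, rowsSpan]
  congr 1
  ext v
  constructor
  · rintro ⟨a, ha, rfl⟩
    exact ⟨a, ha, rfl⟩
  · rintro ⟨a, ha, rfl⟩
    exact ⟨⟨a, lt_of_lt_of_le ha ht⟩, ha, rfl⟩

theorem rowSpace_of {m : ℕ} (row : ℕ → Fin n → K) :
    rowSpace (Matrix.of fun a : Fin m => row a) = rowsSpan row m := by
  rw [rowsSpan_eq_span_range]
  rfl

/-- The dimension formula eliminates the intersection; from here on only sums have to be studied. -/
theorem subspaceDist_eq {U V : Submodule K (Fin n → K)} {t : ℕ}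
    (hU : Module.finrank K U = t) (hV : Module.finrank K V = t) :
    subspaceDist U V = 2 * (Module.finrank K (U ⊔ V : Submodule K (Fin n → K)) - t) := by
  have h1 := Submodule.finrank_sup_add_finrank_inf_eq U V
  have h2 := Submodule.finrank_mono (le_sup_left : U ≤ U ⊔ V)
  rw [subspaceDist]
  omega

end CoordinateTools

/-! ### The field K[x]/(f) as a block of coordinates -/

section BlockVec

open Polynomial

variable {K : Type*} [Field K] {f : Polynomial K} (hm : f.Monic)

/-- The vector with the coefficients of `y ∈ K[x] / (f)` from position `o` on. -/
noncomputable def blockVec (n o : ℕ) : AdjoinRoot f →ₗ[K] (Fin n → K) where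
  toFun y c := if o ≤ (c : ℕ) then (AdjoinRoot.modByMonicHom hm y).coeff (c - o) else 0
  map_add' y y' := by
    ext c
    by_cases h : o ≤ (c : ℕ) <;> simp [h]
  map_smul' a y := by
    ext c
    by_cases h : o ≤ (c : ℕ) <;> simp [h]

theorem blockVec_apply (n o : ℕ) (y : AdjoinRoot f) (c : Fin n) :
    blockVec hm n o y c =
      if o ≤ (c : ℕ) then (AdjoinRoot.modByMonicHom hm y).coeff (c - o) else 0 := rfl

theorem blockVec_apply_of_lt {n o : ℕ} (y : AdjoinRoot f) {c : Fin n} (h : (c : ℕ) < o) :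
    blockVec hm n o y c = 0 := by
  rw [blockVec_apply, if_neg (by omega)]

theorem blockVec_injective {n o : ℕ} (hn : n = o + f.natDegree) :
    Function.Injective (blockVec hm n o) := by
  rw [injective_iff_map_eq_zero]
  intro y hy
  rw [← AdjoinRoot.mk_leftInverse hm y]
  have : AdjoinRoot.modByMonicHom hm y = 0 := by
    ext j
    by_cases hj : j < f.natDegree
    · have := congrFun hy ⟨o + j, by omega⟩
      simpa [blockVec_apply] using this
    · rw [coeff_zero]
      refine coeff_eq_zero_of_degree_lt (lt_of_lt_of_le ?_
        (degree_le_natDegree.trans (Nat.cast_le.2 (not_lt.1 hj))))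
      induction y using AdjoinRoot.induction_on with
      | _ p => exact degree_modByMonic_lt p hm
  rw [this, map_zero]

theorem modByMonicHom_root_pow {a : ℕ} (ha : a < f.natDegree) :
    AdjoinRoot.modByMonicHom hm (AdjoinRoot.root f ^ a) = X ^ a := by
  rw [← AdjoinRoot.mk_X, ← map_pow, AdjoinRoot.modByMonicHom_mk,
    modByMonic_eq_self_iff hm, degree_X_pow, degree_eq_natDegree hm.ne_zero]
  exact_mod_cast ha

/-- The leading terms cancel, so the right side is already reduced. Its coefficients are the last
row of the companion matrix. -/
theorem modByMonicHom_root_pow_natDegree :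
    AdjoinRoot.modByMonicHom hm (AdjoinRoot.root f ^ f.natDegree) = X ^ f.natDegree - f := by
  have h : AdjoinRoot.root f ^ f.natDegree = AdjoinRoot.mk f (X ^ f.natDegree - f) := by
    rw [map_sub, AdjoinRoot.mk_self, sub_zero, map_pow, AdjoinRoot.mk_X]
  rw [h, AdjoinRoot.modByMonicHom_mk, modByMonic_eq_self_iff hm]
  have := degree_sub_lt_left (p := X ^ f.natDegree) (q := f)
    (by rw [degree_X_pow, degree_eq_natDegree hm.ne_zero]) (by simp)
    (by rw [hm.leadingCoeff]; simp)
  rwa [degree_X_pow, ← degree_eq_natDegree hm.ne_zero] at this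

theorem blockVec_root_pow {n o a : ℕ} (ha : a < f.natDegree) :
    blockVec hm n o (AdjoinRoot.root f ^ a) = unitVec K n (o + a) := by
  ext c
  rw [blockVec_apply, modByMonicHom_root_pow hm ha, coeff_X_pow, unitVec]
  split_ifs <;> first | rfl | omega

theorem root_pow_linearMap_ext {V : Type*} [AddCommGroup V] [Module K V]
    {φ ψ : AdjoinRoot f →ₗ[K] V} (hm : f.Monic)
    (h : ∀ a < f.natDegree, φ (AdjoinRoot.root f ^ a) = ψ (AdjoinRoot.root f ^ a)) : φ = ψ := by
  refine (AdjoinRoot.powerBasis' hm).basis.ext fun a => ?_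
  rw [PowerBasis.basis_eq_pow]
  exact h a a.2

theorem linearIndependent_root_pow_mul {y : AdjoinRoot f} (hm : f.Monic) (hf : Irreducible f)
    (hy : y ≠ 0) {t : ℕ} (ht : t ≤ f.natDegree) :
    LinearIndependent K fun a : Fin t => AdjoinRoot.root f ^ (a : ℕ) * y := by
  have := Fact.mk hf
  have h1 := (AdjoinRoot.powerBasis' hm).basis.linearIndependent
  have h2 : LinearMap.ker (LinearMap.mulRight K y) = ⊥ :=
    LinearMap.ker_eq_bot.2 (mul_left_injective₀ hy)
  have h3 := (h1.map' _ h2).comp (Fin.castLE ht) (Fin.castLE_injective ht)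
  have h4 : (fun a : Fin t => AdjoinRoot.root f ^ (a : ℕ) * y) =
      (LinearMap.mulRight K y ∘ (AdjoinRoot.powerBasis' hm).basis) ∘ Fin.castLE ht := by
    ext a
    simp only [Function.comp_apply, PowerBasis.basis_eq_pow, LinearMap.mulRight_apply]
    rfl
  rw [h4]
  exact h3

theorem finrank_rowsSpan_blockVec (hf : Irreducible f) {n o : ℕ} (hn : n = o + f.natDegree)
    {y : AdjoinRoot f} (hy : y ≠ 0) {t : ℕ} (ht : t ≤ f.natDegree) :
    Module.finrank K
      (rowsSpan (fun a => blockVec hm n o (AdjoinRoot.root f ^ a * y)) t) = t := by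
  apply finrank_rowsSpan_of_linearIndependent
  exact (linearIndependent_root_pow_mul hm hf hy ht).map' (blockVec hm n o)
    (LinearMap.ker_eq_bot.2 (blockVec_injective hm hn))

/-- Multiplication by y ≠ 0 is bijective on the field, so the multiples of y by the power basis
again span the whole block. -/
theorem blockVec_mem_of_root_pow_mul {n o : ℕ} (hf : Irreducible f) {y : AdjoinRoot f}
    (hy : y ≠ 0) {W : Submodule K (Fin n → K)}
    (h : ∀ a < f.natDegree, blockVec hm n o (AdjoinRoot.root f ^ a * y) ∈ W)
    (u : AdjoinRoot f) : blockVec hm n o u ∈ W := by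
  have := Fact.mk hf
  have h1 : W.mkQ ∘ₗ blockVec hm n o ∘ₗ LinearMap.mulRight K y = 0 := by
    refine root_pow_linearMap_ext hm fun a ha => ?_
    simpa using h a ha
  have h2 := LinearMap.congr_fun h1 (u * y⁻¹)
  simpa [mul_assoc, inv_mul_cancel₀ hy] using h2

theorem unitVec_mem_of_blockVec_mem {n o b : ℕ} {W : Submodule K (Fin n → K)}
    (hn : n = o + f.natDegree) (h : ∀ u, blockVec hm n o u ∈ W) (hb : o ≤ b) (hbn : b < n) :
    unitVec K n b ∈ W := by
  have := h (AdjoinRoot.root f ^ (b - o))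
  rwa [blockVec_root_pow hm (by omega), show o + (b - o) = b by omega] at this

end BlockVec

/-! ### Row spans of the matrices and lower bounds for their sums -/

section CodeRow

open Polynomial

variable {K : Type*} [Field K] {f : Polynomial K} (hm : f.Monic)

open Classical in
/-- The element itself, with zero replaced by one. -/
noncomputable def zeroToOne (x : AdjoinRoot f) : AdjoinRoot f := if x = 0 then 1 else x

theorem zeroToOne_zero : zeroToOne (0 : AdjoinRoot f) = 1 := if_pos rfl

theorem zeroToOne_of_ne {x : AdjoinRoot f} (hx : x ≠ 0) : zeroToOne x = x := if_neg hx

theorem zeroToOne_ne_zero (hf : Irreducible f) (x : AdjoinRoot f) : zeroToOne x ≠ 0 := by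
  have := Fact.mk hf
  by_cases hx : x = 0
  · rw [hx, zeroToOne_zero]
    exact one_ne_zero
  · rwa [zeroToOne_of_ne hx]

/-- The rows of the matrices `A g` (for `x ≠ 0`) and `B` (for `x = 0`), where the powers of the
companion matrix of `f` are regarded as nonzero elements of `K[x] / (f)`. -/
noncomputable def codeRow (n k z : ℕ) (x : AdjoinRoot f) (a : ℕ) : Fin n → K :=
  if a < k then
    unitVec K n (z + a) + blockVec hm n (z + k) (AdjoinRoot.root f ^ a * x)
  else if a < f.natDegree then
    blockVec hm n (z + k) (AdjoinRoot.root f ^ a * zeroToOne x)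
  else if a < f.natDegree + z then unitVec K n (a - f.natDegree)
  else blockVec hm n (z + k) (AdjoinRoot.root f ^ (a - (f.natDegree + z)) * zeroToOne x)

/-- The span of the first `t` rows of `A g` or `B`. -/
noncomputable def codeSpan (n k z : ℕ) (x : AdjoinRoot f) (t : ℕ) : Submodule K (Fin n → K) :=
  rowsSpan (codeRow hm n k z x) t

variable {n k z t : ℕ}

theorem head_mem_codeSpan (x : AdjoinRoot f) {a : ℕ} (ha : a < k) (hat : a < t) :
    unitVec K n (z + a) + blockVec hm n (z + k) (AdjoinRoot.root f ^ a * x) ∈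
      codeSpan hm n k z x t := by
  have := row_mem_rowsSpan (codeRow hm n k z x) hat
  rwa [codeRow, if_pos ha] at this

theorem blockVec_mem_codeSpan (x : AdjoinRoot f) {a : ℕ} (ha : k ≤ a) (had : a < f.natDegree)
    (hat : a < t) :
    blockVec hm n (z + k) (AdjoinRoot.root f ^ a * zeroToOne x) ∈ codeSpan hm n k z x t := by
  have := row_mem_rowsSpan (codeRow hm n k z x) hat
  rwa [codeRow, if_neg (by omega), if_pos had] at this

theorem unitVec_mem_codeSpan (x : AdjoinRoot f) (hkd : k ≤ f.natDegree) {b : ℕ} (hb : b < z)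
    (hbt : f.natDegree + b < t) : unitVec K n b ∈ codeSpan hm n k z x t := by
  have := row_mem_rowsSpan (codeRow hm n k z x) hbt
  rwa [codeRow, if_neg (by omega), if_neg (by omega), if_pos (by omega),
    Nat.add_sub_cancel_left] at this

theorem tail_mem_codeSpan (x : AdjoinRoot f) (hkd : k ≤ f.natDegree) {a : ℕ}
    (hat : f.natDegree + z + a < t) :
    blockVec hm n (z + k) (AdjoinRoot.root f ^ a * zeroToOne x) ∈ codeSpan hm n k z x t := by
  have := row_mem_rowsSpan (codeRow hm n k z x) hat
  rwa [codeRow, if_neg (by omega), if_neg (by omega), if_neg (by omega),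
    Nat.add_sub_cancel_left] at this

theorem unitVec_mem_codeSpan_zero {b : ℕ} (hb : z + 2 * k ≤ b)
    (hbt : b < z + k + t) (hbn : b < z + k + f.natDegree) :
    unitVec K n b ∈ codeSpan hm n k z 0 t := by
  have := blockVec_mem_codeSpan hm (n := n) (z := z) (0 : AdjoinRoot f)
    (a := b - (z + k)) (t := t) (k := k) (by omega) (by omega) (by omega)
  rwa [zeroToOne_zero, mul_one, blockVec_root_pow hm (by omega),
    show z + k + (b - (z + k)) = b by omega] at this

/-- Among the columns before z, column c is met only by row deg f + c, in the block I_z. -/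
theorem codeSpan_apply_eq_zero (x : AdjoinRoot f) {c : Fin n} (hc : (c : ℕ) < z)
    (ht : t ≤ f.natDegree + c) : ∀ v ∈ codeSpan hm n k z x t, v c = 0 := by
  refine rowsSpan_apply_eq_zero fun a ha => ?_
  have hlt : (c : ℕ) < z + k := by omega
  rw [codeRow]
  split_ifs
  · rw [Pi.add_apply, blockVec_apply_of_lt hm _ hlt, unitVec, if_neg (by omega), add_zero]
  · rw [blockVec_apply_of_lt hm _ hlt]
  · rw [unitVec, if_neg (by omega)]
  · rw [blockVec_apply_of_lt hm _ hlt]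

/-- The n - 1 rows together with one more vector span the whole space, so they are independent. -/
theorem finrank_codeSpan (hf : Irreducible f) (hn : n = z + k + f.natDegree)
    (hkd : k ≤ f.natDegree) (hk : 1 ≤ k) (x : AdjoinRoot f) (ht : t ≤ n - 1) :
    Module.finrank K (codeSpan hm n k z x t) = t := by
  refine finrank_rowsSpan
    (le_finrank_of_sup_span_singleton_eq_top
      -- The exponent k - 1 is the only one missing: the last rows supply the exponents below k - 1,
      -- the middle rows those from k on.
      (v := blockVec hm n (z + k) (AdjoinRoot.root f ^ (k - 1) * zeroToOne x)) ?_) ht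
  change codeSpan hm n k z x (n - 1) ⊔ _ = ⊤
  set W := codeSpan hm n k z x (n - 1) ⊔ Submodule.span K
    {blockVec hm n (z + k) (AdjoinRoot.root f ^ (k - 1) * zeroToOne x)}
  have hU : codeSpan hm n k z x (n - 1) ≤ W := le_sup_left
  have hall : ∀ u, blockVec hm n (z + k) u ∈ W := by
    refine blockVec_mem_of_root_pow_mul hm hf (zeroToOne_ne_zero hf x) fun a ha => ?_
    rcases lt_or_ge a (k - 1) with h1 | h1
    · exact hU (tail_mem_codeSpan hm x hkd (by omega))
    rcases h1.eq_or_lt with h2 | h2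
    · rw [← h2]
      exact Submodule.mem_sup_right (Submodule.mem_span_singleton_self _)
    · exact hU (blockVec_mem_codeSpan hm x (by omega) ha (by omega))
  refine eq_top_of_unitVec_mem fun b hb => ?_
  rcases lt_or_ge b z with h1 | h1
  · exact hU (unitVec_mem_codeSpan hm x hkd h1 (by omega))
  rcases lt_or_ge b (z + k) with h2 | h2
  · have h3 := hU (head_mem_codeSpan hm (n := n) (z := z) x (a := b - z) (k := k)
      (t := n - 1) (by omega) (by omega))
    rw [show z + (b - z) = b by omega] at h3
    exact (Submodule.add_mem_iff_left W (hall _)).1 h3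
  · exact unitVec_mem_of_blockVec_mem hm hn hall h2 hb

theorem head_apply (x : AdjoinRoot f) {b : ℕ} {c : Fin n} (hc : (c : ℕ) < z + k) :
    (unitVec K n b + blockVec hm n (z + k) x) c = if (c : ℕ) = b then 1 else 0 := by
  rw [Pi.add_apply, blockVec_apply_of_lt hm _ hc, add_zero, unitVec]

/-- In head rows the unit vectors cancel. In middle rows one subtracts if both labels are nonzero;
if one is zero, the row of the other is already the difference up to sign. -/
theorem blockVec_sub_mem (x x' : AdjoinRoot f) (hne : x ≠ x') {a : ℕ} (hat : a < t)
    (had : a < f.natDegree) :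
    blockVec hm n (z + k) (AdjoinRoot.root f ^ a * (x - x')) ∈
      codeSpan hm n k z x t ⊔ codeSpan hm n k z x' t := by
  have hl : codeSpan hm n k z x t ≤ codeSpan hm n k z x t ⊔ codeSpan hm n k z x' t := le_sup_left
  have hr : codeSpan hm n k z x' t ≤ codeSpan hm n k z x t ⊔ codeSpan hm n k z x' t := le_sup_right
  rcases lt_or_ge a k with h | h
  · have := sub_mem (hl (head_mem_codeSpan hm x h hat)) (hr (head_mem_codeSpan hm x' h hat))
    rwa [add_sub_add_left_eq_sub, ← map_sub, ← mul_sub] at this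
  · have h1 := hl (blockVec_mem_codeSpan hm (n := n) (z := z) x h had hat)
    have h2 := hr (blockVec_mem_codeSpan hm (n := n) (z := z) x' h had hat)
    by_cases hx : x = 0
    · have hx' : x' ≠ 0 := fun h => hne (hx.trans h.symm)
      rw [zeroToOne_of_ne hx'] at h2
      subst hx
      rw [zero_sub, mul_neg, map_neg]
      exact neg_mem h2
    · rw [zeroToOne_of_ne hx] at h1
      by_cases hx' : x' = 0
      · rwa [hx', sub_zero, ← hx']
      · rw [zeroToOne_of_ne hx'] at h2
        rw [mul_sub, map_sub]
        exact sub_mem h1 h2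

/-- Two distinct matrices with the same block structure. -/
theorem le_finrank_sup_codeSpan_same (hf : Irreducible f) (hn : n = z + k + f.natDegree)
    (hkd : k ≤ f.natDegree) {x x' : AdjoinRoot f} (hne : x ≠ x') (t : ℕ) :
    min t (f.natDegree + z) + min t k ≤
      Module.finrank K
        (codeSpan hm n k z x t ⊔ codeSpan hm n k z x' t : Submodule K (Fin n → K)) := by
  have h1 := finrank_rowsSpan_blockVec hm hf hn (sub_ne_zero.2 hne)
    (min_le_right t f.natDegree)
  -- The differences vanish before column z + k. The free columns there are those reached by the
  -- head rows and those reached by the rows of I_z.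
  have h2 := finrank_add_card_le (W := codeSpan hm n k z x t ⊔ codeSpan hm n k z x' t)
    (Finset.Ico z (z + min t k) ∪ Finset.range (min (t - f.natDegree) z))
    (rowsSpan_le fun a (ha : a < min t f.natDegree) =>
      blockVec_sub_mem hm x x' hne (a := a) (by omega) (by omega)) ?_ ?_ ?_
  · rw [h1, Finset.card_union_of_disjoint, Nat.card_Ico, Finset.card_range] at h2
    · omega
    · rw [Finset.disjoint_left]
      intro b hb hb'
      rw [Finset.mem_Ico] at hb
      rw [Finset.mem_range] at hb'
      omega
  · intro b hb
    simp only [Finset.mem_union, Finset.mem_Ico, Finset.mem_range] at hb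
    omega
  · intro v hv c hc
    simp only [Finset.mem_union, Finset.mem_Ico, Finset.mem_range] at hc
    exact rowsSpan_apply_eq_zero (fun a _ => blockVec_apply_of_lt hm _ (by omega)) v hv
  · intro b hb
    simp only [Finset.mem_union, Finset.mem_Ico, Finset.mem_range] at hb
    rcases hb with hb | hb
    · refine ⟨_, Submodule.mem_sup_left
        (head_mem_codeSpan hm x (a := b - z) (by omega) (by omega)), fun c hc => ?_⟩
      simp only [Finset.mem_union, Finset.mem_Ico, Finset.mem_range] at hc
      rw [head_apply hm _ (by omega), show z + (b - z) = b by omega]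
    · exact ⟨_, Submodule.mem_sup_left (unitVec_mem_codeSpan hm x hkd (b := b) (by omega)
        (by omega)), fun c _ => rfl⟩

/-- A subspace that vanishes on the positions of the leading identity block. -/
theorem le_finrank_sup_codeSpan_of_vanish {S : Submodule K (Fin n → K)}
    (hn : n = z + k + f.natDegree)
    (hS : ∀ c : Fin n, z ≤ c → (c : ℕ) < z + k → ∀ v ∈ S, v c = 0) (x : AdjoinRoot f) (t : ℕ) :
    Module.finrank K S + min t k ≤
      Module.finrank K (S ⊔ codeSpan hm n k z x t : Submodule K (Fin n → K)) := by
  have h2 := finrank_add_card_le (W := S ⊔ codeSpan hm n k z x t)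
    (Finset.Ico z (z + min t k)) le_sup_left ?_ ?_ ?_
  · rw [Nat.card_Ico] at h2
    omega
  · intro b hb
    rw [Finset.mem_Ico] at hb
    omega
  · intro v hv c hc
    rw [Finset.mem_Ico] at hc
    exact hS c hc.1 (by omega) v hv
  · intro b hb
    rw [Finset.mem_Ico] at hb
    refine ⟨_, Submodule.mem_sup_right
        (head_mem_codeSpan hm x (a := b - z) (by omega) (by omega)), fun c hc => ?_⟩
    rw [Finset.mem_Ico] at hc
    rw [head_apply hm _ (by omega), show z + (b - z) = b by omega]

/-- A subspace that vanishes on the first `k` positions. -/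
theorem le_finrank_sup_codeSpan_of_vanish_first {S : Submodule K (Fin n → K)}
    (hn : n = z + k + f.natDegree) (hkd : k ≤ f.natDegree) (hkz : k ≤ z)
    (hS : ∀ c : Fin n, (c : ℕ) < k → ∀ v ∈ S, v c = 0) (x : AdjoinRoot f)
    (ht : f.natDegree + k ≤ t) :
    Module.finrank K S + k ≤
      Module.finrank K (S ⊔ codeSpan hm n k z x t : Submodule K (Fin n → K)) := by
  have h2 := finrank_add_card_le (W := S ⊔ codeSpan hm n k z x t)
    (Finset.range k) le_sup_left ?_ ?_ ?_
  · rwa [Finset.card_range] at h2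
  · intro b hb
    rw [Finset.mem_range] at hb
    omega
  · intro v hv c hc
    rw [Finset.mem_range] at hc
    exact hS c hc v hv
  · intro b hb
    rw [Finset.mem_range] at hb
    exact ⟨_, Submodule.mem_sup_right (unitVec_mem_codeSpan hm x hkd (b := b) (by omega)
        (by omega)), fun c _ => rfl⟩

/-- The span of the first `t` rows of the matrix `M`. -/
def antidiagSpan (K : Type*) [Field K] (n t : ℕ) : Submodule K (Fin n → K) :=
  rowsSpan (fun a => unitVec K n (n - 1 - a)) t

theorem unitVec_mem_antidiagSpan {b : ℕ} (hb : b < n) (hbt : n - t ≤ b) :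
    unitVec K n b ∈ antidiagSpan K n t := by
  have := row_mem_rowsSpan (fun a => unitVec K n (n - 1 - a)) (a := n - 1 - b) (t := t) (by omega)
  rwa [show n - 1 - (n - 1 - b) = b by omega] at this

theorem antidiagSpan_apply_eq_zero {c : Fin n} (hc : (c : ℕ) + t < n) :
    ∀ v ∈ antidiagSpan K n t, v c = 0 :=
  rowsSpan_apply_eq_zero fun a ha => by rw [unitVec, if_neg (by omega)]

theorem finrank_antidiagSpan (ht : t ≤ n - 1) :
    Module.finrank K (antidiagSpan K n t) = t := by
  refine finrank_rowsSpan
    (le_finrank_of_sup_span_singleton_eq_top (v := unitVec K n 0) ?_) ht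
  change antidiagSpan K n (n - 1) ⊔ _ = ⊤
  refine eq_top_of_unitVec_mem fun b hb => ?_
  rcases Nat.eq_zero_or_pos b with rfl | h
  · exact Submodule.mem_sup_right (Submodule.mem_span_singleton_self _)
  · exact Submodule.mem_sup_left (unitVec_mem_antidiagSpan hb (by omega))

/-- In high dimensions the row spaces together with those of `M` span everything. -/
theorem antidiagSpan_sup_codeSpan_eq_top (hf : Irreducible f)
    (hkd : k ≤ f.natDegree) (hz : z = 0 ∨ k ≤ z) (hn : n = z + k + f.natDegree)
    (x : AdjoinRoot f) (ht : n ≤ t + k) (hkt : k ≤ t) :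
    antidiagSpan K n t ⊔ codeSpan hm n k z x t = ⊤ := by
  have := Fact.mk hf
  set W := antidiagSpan K n t ⊔ codeSpan hm n k z x t
  have hr : codeSpan hm n k z x t ≤ W := le_sup_right
  have hl : antidiagSpan K n t ≤ W := le_sup_left
  refine eq_top_of_unitVec_mem fun b hb => ?_
  rcases lt_or_ge b k with h1 | h1
  · rcases hz with rfl | hz
    · have h3 := hr (head_mem_codeSpan hm (n := n) (z := 0) x h1 (by omega))
      rw [zero_add, zero_add] at h3
      refine (Submodule.add_mem_iff_left W ?_).1 h3
      -- With z = 0 the field block starts at column k ≥ n - t, so M contains all of it, and it can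
      -- be subtracted from the head row.
      refine blockVec_mem_of_root_pow_mul hm hf one_ne_zero (fun a ha => ?_) _
      rw [mul_one, blockVec_root_pow hm ha]
      exact hl (unitVec_mem_antidiagSpan (by omega) (by omega))
    · exact hr (unitVec_mem_codeSpan hm x hkd (by omega) (by omega))
  · exact hl (unitVec_mem_antidiagSpan hb (by omega))

variable {f' : Polynomial K} (hm' : f'.Monic) {z' : ℕ}

/-- In high dimensions the row spaces for different block structures span everything. -/
theorem codeSpan_sup_codeSpan_eq_top (hf : Irreducible f) (hf' : Irreducible f')
    (hkd : k ≤ f.natDegree)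
    (hn : n = z + k + f.natDegree) (hn' : n = z' + k + f'.natDegree) (hz : z' + k ≤ z)
    (x : AdjoinRoot f) (x' : AdjoinRoot f') (ht : n ≤ t + k) :
    codeSpan hm n k z x t ⊔ codeSpan hm' n k z' x' t = ⊤ := by
  have := Fact.mk hf
  set W := codeSpan hm n k z x t ⊔ codeSpan hm' n k z' x' t
  have hl : codeSpan hm n k z x t ≤ W := le_sup_left
  have hr : codeSpan hm' n k z' x' t ≤ W := le_sup_right
  have hu : ∀ b < z, unitVec K n b ∈ W := fun b hb =>
    hl (unitVec_mem_codeSpan hm x hkd hb (by omega))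
  refine eq_top_of_unitVec_mem fun b hb => ?_
  -- If x' = 0, the second matrix supplies unit vectors that clear the field part of the head rows
  -- of the first. If x' ≠ 0, the block I_z of the first clears the unit vectors in the head rows of
  -- the second, as z' + k ≤ z.
  by_cases hx' : x' = 0
  · subst hx'
    have h2 : ∀ b < n, z' + 2 * k ≤ b → unitVec K n b ∈ W := fun b hb hb' =>
      hr (unitVec_mem_codeSpan_zero hm' hb' (by omega) (by omega))
    have h3 : ∀ u, blockVec hm n (z + k) u ∈ W := by
      refine blockVec_mem_of_root_pow_mul hm hf one_ne_zero fun a ha => ?_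
      rw [mul_one, blockVec_root_pow hm ha]
      exact h2 _ (by omega) (by omega)
    rcases lt_or_ge b z with h4 | h4
    · exact hu b h4
    rcases lt_or_ge b (z' + 2 * k) with h5 | h5
    · have h6 := hl (head_mem_codeSpan hm (n := n) (z := z) (k := k) (t := t) x (a := b - z)
        (by omega) (by omega))
      rw [show z + (b - z) = b by omega] at h6
      exact (Submodule.add_mem_iff_left W (h3 _)).1 h6
    · exact h2 b hb h5
  · have h3 : ∀ u, blockVec hm' n (z' + k) u ∈ W := by
      refine blockVec_mem_of_root_pow_mul hm' hf' hx' fun a ha => ?_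
      rcases lt_or_ge a k with h | h
      · have h6 := hr (head_mem_codeSpan hm' (n := n) (z := z') (k := k) (t := t) x' h
          (by omega))
        exact (Submodule.add_mem_iff_right W (hu _ (by omega))).1 h6
      · have h6 := hr (blockVec_mem_codeSpan hm' (n := n) (z := z') (k := k) (t := t) x' h ha
          (by omega))
        rwa [zeroToOne_of_ne hx'] at h6
    rcases lt_or_ge b (z' + k) with h4 | h4
    · exact hu b (by omega)
    · exact unitVec_mem_of_blockVec_mem hm' hn' h3 h4 hb

end CodeRow

/-! ### The block structures i = 1 and i = 3, and the pair B_1, B_3 -/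

section ExtremalPair

open Polynomial

variable {K : Type*} [Field K] {f f' : Polynomial K} (hm : f.Monic) (hm' : f'.Monic)
  {n k h z t : ℕ}

theorem card_le_finrank_of_unitVec_mem {W : Submodule K (Fin n → K)} (B : Finset ℕ)
    (hBn : ∀ b ∈ B, b < n) (hW : ∀ b ∈ B, unitVec K n b ∈ W) :
    B.card ≤ Module.finrank K W := by
  have := finrank_add_card_le (S := ⊥) (W := W) B bot_le hBn
    (fun v hv c _ => by rw [(Submodule.mem_bot K).1 hv]; rfl)
    (fun b hb => ⟨_, hW b hb, fun _ _ => rfl⟩)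
  rwa [finrank_bot, zero_add] at this

theorem finrank_le_card_of_le_span_unitVec {W : Submodule K (Fin n → K)} (B : Finset ℕ)
    (hW : W ≤ Submodule.span K (unitVec K n '' B)) : Module.finrank K W ≤ B.card := by
  classical
  refine (Submodule.finrank_mono hW).trans ?_
  rw [← Finset.coe_image]
  exact (finrank_span_finset_le_card _).trans Finset.card_image_le

/-- For the label 0 all rows are unit vectors; the bound on t leaves out the repeated field rows at
the end. -/
theorem codeSpan_zero_le (ht : t ≤ f.natDegree + z) {W : Submodule K (Fin n → K)}
    (h1 : ∀ a < t, a < k → unitVec K n (z + a) ∈ W)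
    (h2 : ∀ a < t, k ≤ a → a < f.natDegree → unitVec K n (z + k + a) ∈ W)
    (h3 : ∀ b < z, f.natDegree + b < t → unitVec K n b ∈ W) :
    codeSpan hm n k z 0 t ≤ W := by
  refine rowsSpan_le fun a ha => ?_
  rw [codeRow]
  split_ifs with h4 h5 h6
  · rw [mul_zero, map_zero, add_zero]
    exact h1 a ha h4
  · rw [zeroToOne_zero, mul_one, blockVec_root_pow hm h5]
    exact h2 a ha (by omega) h5
  · exact h3 _ (by omega) (by omega)
  · omega

/-- The dimension `2 k + h` for the block structures of `i = 1` and `i = 3`, when at least one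
of the matrices is not the matrix `B`. -/
theorem le_finrank_sup_codeSpan_one_three (hf : Irreducible f) (hf' : Irreducible f')
    (hd : f.natDegree = k + h) (hd' : f'.natDegree = 3 * k + h) (hn : n = 4 * k + h)
    {x : AdjoinRoot f} {x' : AdjoinRoot f'} (hne : x ≠ 0 ∨ x' ≠ 0) :
    3 * k + h ≤ Module.finrank K (codeSpan hm n k (2 * k) x (2 * k + h) ⊔
      codeSpan hm' n k 0 x' (2 * k + h) : Submodule K (Fin n → K)) := by
  set W := codeSpan hm n k (2 * k) x (2 * k + h) ⊔ codeSpan hm' n k 0 x' (2 * k + h)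
  have hl : codeSpan hm n k (2 * k) x (2 * k + h) ≤ W := le_sup_left
  have hr : codeSpan hm' n k 0 x' (2 * k + h) ≤ W := le_sup_right
  have hu : ∀ b < k, unitVec K n b ∈ W := fun b hb =>
    hl (unitVec_mem_codeSpan hm x (by omega) (by omega) (by omega))
  by_cases hx' : x' = 0
  · have hx : x ≠ 0 := hne.resolve_right (not_not.2 hx')
    subst hx'
    have hu' : ∀ b, 2 * k ≤ b → b < 3 * k → unitVec K n b ∈ W := fun b h1 h2 =>
      hr (unitVec_mem_codeSpan_zero hm' (by omega) (by omega) (by omega))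
    -- B_3 contains the unit vectors of the head of the first matrix, so all of its last k + h
    -- columns are obtained, besides two intervals of k unit vectors.
    have h1 := finrank_rowsSpan_blockVec hm hf (o := 2 * k + k) (n := n) (by omega) hx le_rfl
    have h2 := finrank_add_card_le
      (S := rowsSpan (fun a => blockVec hm n (2 * k + k) (AdjoinRoot.root f ^ a * x)) f.natDegree)
      (W := W) (Finset.range k ∪ Finset.Ico (2 * k) (3 * k)) (rowsSpan_le fun a ha => ?_) ?_ ?_ ?_
    · rw [h1, Finset.card_union_of_disjoint, Nat.card_Ico, Finset.card_range] at h2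
      · omega
      · rw [Finset.disjoint_left]
        intro b hb hb'
        rw [Finset.mem_Ico] at hb'
        rw [Finset.mem_range] at hb
        omega
    · rcases lt_or_ge a k with h4 | h4
      · have h3 := hl (head_mem_codeSpan hm (n := n) (z := 2 * k) (t := 2 * k + h) x h4
          (by omega))
        exact (Submodule.add_mem_iff_right W (hu' _ (by omega) (by omega))).1 h3
      · have h3 := hl (blockVec_mem_codeSpan hm (n := n) (z := 2 * k) (t := 2 * k + h) x h4 ha
          (by omega))
        rwa [zeroToOne_of_ne hx] at h3
    · intro b hb
      simp only [Finset.mem_union, Finset.mem_Ico, Finset.mem_range] at hb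
      omega
    · intro v hv c hc
      simp only [Finset.mem_union, Finset.mem_Ico, Finset.mem_range] at hc
      exact rowsSpan_apply_eq_zero (fun a _ => blockVec_apply_of_lt hm _ (by omega)) v hv
    · intro b hb
      simp only [Finset.mem_union, Finset.mem_Ico, Finset.mem_range] at hb
      refine ⟨_, ?_, fun c _ => rfl⟩
      rcases hb with hb | hb
      · exact hu b hb
      · exact hu' b hb.1 hb.2
  -- The first k unit vectors clear the head of the second matrix, leaving 2k + h independent field
  -- vectors that vanish on the first k columns.
  · have h1 := finrank_rowsSpan_blockVec hm' hf' (o := 0 + k) (n := n) (by omega) hx'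
      (t := 2 * k + h) (by omega)
    have h2 := finrank_add_card_le
      (S := rowsSpan (fun a => blockVec hm' n (0 + k) (AdjoinRoot.root f' ^ a * x')) (2 * k + h))
      (W := W) (Finset.range k) (rowsSpan_le fun a ha => ?_) ?_ ?_ ?_
    · rw [h1, Finset.card_range] at h2
      omega
    · rcases lt_or_ge a k with h4 | h4
      · have h3 := hr (head_mem_codeSpan hm' (n := n) (z := 0) (t := 2 * k + h) x' h4
          (by omega))
        exact (Submodule.add_mem_iff_right W (hu _ (by omega))).1 h3
      · have h3 := hr (blockVec_mem_codeSpan hm' (n := n) (z := 0) (t := 2 * k + h) x' h4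
          (by omega) (by omega))
        rwa [zeroToOne_of_ne hx'] at h3
    · intro b hb
      rw [Finset.mem_range] at hb
      omega
    · intro v hv c hc
      rw [Finset.mem_range] at hc
      exact rowsSpan_apply_eq_zero (fun a _ => blockVec_apply_of_lt hm' _ (by omega)) v hv
    · intro b hb
      rw [Finset.mem_range] at hb
      exact ⟨_, hu b hb, fun c _ => rfl⟩

theorem card_range_union_Ico_union_Ico {p q r s u : ℕ} (h1 : p ≤ q) (h2 : r ≤ s)
    (h3 : p ≤ s) :
    (Finset.range p ∪ (Finset.Ico q r ∪ Finset.Ico s u)).card = p + ((r - q) + (u - s)) := by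
  rw [Finset.card_union_of_disjoint, Finset.card_union_of_disjoint, Nat.card_Ico, Nat.card_Ico,
    Finset.card_range]
  · rw [Finset.disjoint_left]
    intro b hb hb'
    rw [Finset.mem_Ico] at hb hb'
    omega
  · rw [Finset.disjoint_left]
    intro b hb hb'
    simp only [Finset.mem_union, Finset.mem_Ico, Finset.mem_range] at hb hb'
    omega

/-- The dimension `2 k + h` for the matrices `B` with `i = 1` and `i = 3`. -/
theorem finrank_sup_codeSpan_zero (hd : f.natDegree = k + h) (hd' : f'.natDegree = 3 * k + h)
    (hn : n = 4 * k + h) (hh : h < k) :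
    Module.finrank K (codeSpan hm n k (2 * k) 0 (2 * k + h) ⊔
      codeSpan hm' n k 0 0 (2 * k + h) : Submodule K (Fin n → K)) = 2 * k + 2 * h := by
  -- B_1 consists of the unit vectors on [0,k), [2k,3k), [4k,4k+h), and B_3 of those on [0,k),
  -- [2k,3k+h). As h < k, the three intervals of the union are disjoint.
  have hc := card_range_union_Ico_union_Ico (p := k) (q := 2 * k) (r := 3 * k + h) (s := 4 * k)
    (u := 4 * k + h) (by omega) (by omega) (by omega)
  apply le_antisymm
  · rw [show 2 * k + 2 * h = k + (3 * k + h - 2 * k + (4 * k + h - 4 * k)) by omega, ← hc]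
    have hmem : ∀ b, (b < k ∨ 2 * k ≤ b ∧ b < 3 * k + h ∨ 4 * k ≤ b ∧ b < 4 * k + h) →
        unitVec K n b ∈ Submodule.span K (unitVec K n '' ((Finset.range k ∪
          (Finset.Ico (2 * k) (3 * k + h) ∪ Finset.Ico (4 * k) (4 * k + h)) : Finset ℕ) :
            Set ℕ)) :=
      fun b hb => Submodule.subset_span ⟨b, by simpa using hb, rfl⟩
    refine finrank_le_card_of_le_span_unitVec _ (sup_le ?_ ?_)
    · exact codeSpan_zero_le hm (by omega) (fun a _ _ => hmem _ (by omega))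
        (fun a _ _ _ => hmem _ (by omega)) (fun b _ _ => hmem _ (by omega))
    · exact codeSpan_zero_le hm' (by omega) (fun a _ _ => hmem _ (by omega))
        (fun a _ _ _ => hmem _ (by omega)) (fun b _ _ => hmem _ (by omega))
  · rw [show 2 * k + 2 * h = k + (3 * k + h - 2 * k + (4 * k + h - 4 * k)) by omega, ← hc]
    refine card_le_finrank_of_unitVec_mem _ (fun b hb => ?_) fun b hb => ?_
    · simp only [Finset.mem_union, Finset.mem_Ico, Finset.mem_range] at hb
      omega
    · simp only [Finset.mem_union, Finset.mem_Ico, Finset.mem_range] at hb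
      rcases hb with hb | hb | hb
      · exact Submodule.mem_sup_left (unitVec_mem_codeSpan hm 0 (by omega) (by omega) (by omega))
      · exact Submodule.mem_sup_right
          (unitVec_mem_codeSpan_zero hm' (by omega) (by omega) (by omega))
      · exact Submodule.mem_sup_left
          (unitVec_mem_codeSpan_zero hm (by omega) (by omega) (by omega))

/-- The dimensions up to `k + h` for the matrices `B` with `i = 1` and `i = 3`. -/
theorem finrank_sup_codeSpan_zero_le (hd : f.natDegree = k + h) (hd' : f'.natDegree = 3 * k + h)
    (hh : h < k) (ht : t ≤ k + h) :
    Module.finrank K (codeSpan hm n k (2 * k) 0 t ⊔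
      codeSpan hm' n k 0 0 t : Submodule K (Fin n → K)) ≤ t + min t k := by
  rcases le_or_gt t k with h1 | h1
  -- Only head rows occur: [0,t) from B_3 and [2k,2k+t) from B_1. The third interval is empty.
  · have hc := card_range_union_Ico_union_Ico (p := t) (q := 2 * k)
      (r := 2 * k + t) (s := 2 * k + t) (u := 2 * k + t) (by omega) (by omega) (by omega)
    rw [show t + min t k = t + (2 * k + t - 2 * k + (2 * k + t - (2 * k + t))) by omega, ← hc]
    have hmem : ∀ b, (b < t ∨ 2 * k ≤ b ∧ b < 2 * k + t) →
        unitVec K n b ∈ Submodule.span K (unitVec K n '' ((Finset.range t ∪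
          (Finset.Ico (2 * k) (2 * k + t) ∪ Finset.Ico (2 * k + t) (2 * k + t)) : Finset ℕ) :
            Set ℕ)) :=
      fun b hb => Submodule.subset_span ⟨b, by simpa using hb, rfl⟩
    refine finrank_le_card_of_le_span_unitVec _ (sup_le ?_ ?_)
    · exact codeSpan_zero_le hm (by omega) (fun a _ _ => hmem _ (by omega))
        (fun a _ _ _ => by omega) (fun b _ _ => by omega)
    · exact codeSpan_zero_le hm' (by omega) (fun a _ _ => hmem _ (by omega))
        (fun a _ _ _ => by omega) (fun b _ _ => by omega)
  -- Since t ≤ k + h < 2k, the middle rows of B_3 stay inside [2k,3k), where B_1 has its head; only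
  -- those of B_1, in [4k,3k+t), are new.
  · have hc := card_range_union_Ico_union_Ico (p := k) (q := 2 * k)
      (r := 3 * k) (s := 4 * k) (u := 3 * k + t) (by omega) (by omega) (by omega)
    rw [show t + min t k = k + (3 * k - 2 * k + (3 * k + t - 4 * k)) by omega, ← hc]
    have hmem : ∀ b, (b < k ∨ 2 * k ≤ b ∧ b < 3 * k ∨ 4 * k ≤ b ∧ b < 3 * k + t) →
        unitVec K n b ∈ Submodule.span K (unitVec K n '' ((Finset.range k ∪
          (Finset.Ico (2 * k) (3 * k) ∪ Finset.Ico (4 * k) (3 * k + t)) : Finset ℕ) :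
            Set ℕ)) :=
      fun b hb => Submodule.subset_span ⟨b, by simpa using hb, rfl⟩
    refine finrank_le_card_of_le_span_unitVec _ (sup_le ?_ ?_)
    · exact codeSpan_zero_le hm (by omega) (fun a _ _ => hmem _ (by omega))
        (fun a _ _ _ => hmem _ (by omega)) (fun b _ _ => by omega)
    · exact codeSpan_zero_le hm' (by omega) (fun a _ _ => hmem _ (by omega))
        (fun a _ _ _ => hmem _ (by omega)) (fun b _ _ => by omega)

end ExtremalPair

/-! ### The groups G_i as multiplicative groups of fields -/

section CyclicGroup

open Polynomial Matrix

variable {K : Type*} [Field K]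

theorem unitVec_vecMul {n m : ℕ} (M : Matrix (Fin n) (Fin m) K) {b : ℕ} (hb : b < n) :
    unitVec K n b ᵥ* M = M ⟨b, hb⟩ := by
  have : unitVec K n b = Pi.single ⟨b, hb⟩ 1 := unitVec_eq_single ⟨b, hb⟩
  rw [this, single_one_vecMul]
  rfl

theorem blockDiag_apply_of_lt {s k h i : ℕ} (hi : i < s)
    (X : Matrix (Fin (i * k + h)) (Fin (i * k + h)) K) {a : Fin (s * k + h)}
    (ha : (a : ℕ) < (s - i - 1) * k + k) :
    blockDiag s k h i hi X a = unitVec K (s * k + h) a := by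
  ext c
  obtain ⟨a | a, rfl⟩ := (finSumFinEquiv.trans (finCongr (dim_split s k h i hi))).surjective a
  · obtain ⟨c | c, rfl⟩ := (finSumFinEquiv.trans (finCongr (dim_split s k h i hi))).surjective c
    · rw [blockDiag, reindex_apply, submatrix_apply, Equiv.symm_apply_apply,
        Equiv.symm_apply_apply, fromBlocks_apply₁₁, one_apply, unitVec]
      simp [Fin.ext_iff, eq_comm]
    · rw [blockDiag, reindex_apply, submatrix_apply, Equiv.symm_apply_apply,
        Equiv.symm_apply_apply, fromBlocks_apply₁₂, unitVec, Matrix.zero_apply, if_neg]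
      have := a.2
      simp
      omega
  · simp at ha

theorem blockDiag_apply_of_le {s k h i : ℕ} (hi : i < s)
    (X : Matrix (Fin (i * k + h)) (Fin (i * k + h)) K) {a : Fin (s * k + h)}
    (a' : Fin (i * k + h)) (ha : (a : ℕ) = (s - i - 1) * k + k + a') (c : Fin (s * k + h)) :
    blockDiag s k h i hi X a c =
      if hc : (s - i - 1) * k + k ≤ (c : ℕ) then
        X a' ⟨c - ((s - i - 1) * k + k), by have := dim_split s k h i hi; omega⟩ else 0 := by
  have ha : a = finSumFinEquiv.trans (finCongr (dim_split s k h i hi)) (Sum.inr a') := by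
    ext
    simpa using ha
  subst ha
  obtain ⟨c | c, rfl⟩ := (finSumFinEquiv.trans (finCongr (dim_split s k h i hi))).surjective c
  · rw [blockDiag, reindex_apply, submatrix_apply, Equiv.symm_apply_apply,
      Equiv.symm_apply_apply, fromBlocks_apply₂₁, Matrix.zero_apply, dif_neg]
    simp
  · rw [blockDiag, reindex_apply, submatrix_apply, Equiv.symm_apply_apply,
      Equiv.symm_apply_apply, fromBlocks_apply₂₂, dif_pos (by simp)]
    congr 1
    ext
    simp

variable {f : Polynomial K} (hm : f.Monic)

/-- Right multiplication by the matrix `g` fixes the unit vectors before position `o`, and acts as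
multiplication by `x` on the vectors that stand for elements of `K[x] / (f)`. -/
structure ActsAs {n : ℕ} (o : ℕ) (g : Matrix (Fin n) (Fin n) K) (x : AdjoinRoot f) : Prop where
  unitVec_vecMul : ∀ b < o, unitVec K n b ᵥ* g = unitVec K n b
  blockVec_vecMul : ∀ y, blockVec hm n o y ᵥ* g = blockVec hm n o (x * y)

variable {hm}

theorem ActsAs.one {n o : ℕ} : ActsAs hm o (1 : Matrix (Fin n) (Fin n) K) 1 where
  unitVec_vecMul b _ := vecMul_one _
  blockVec_vecMul y := by rw [vecMul_one, one_mul]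

theorem ActsAs.mul {n o : ℕ} {g g' : Matrix (Fin n) (Fin n) K} {x x' : AdjoinRoot f}
    (hg : ActsAs hm o g x) (hg' : ActsAs hm o g' x') : ActsAs hm o (g * g') (x * x') where
  unitVec_vecMul b hb := by
    rw [← vecMul_vecMul, hg.unitVec_vecMul b hb, hg'.unitVec_vecMul b hb]
  blockVec_vecMul y := by
    rw [← vecMul_vecMul, hg.blockVec_vecMul y, hg'.blockVec_vecMul, ← mul_assoc, mul_comm x']

theorem ActsAs.pow {n o : ℕ} {g : Matrix (Fin n) (Fin n) K} {x : AdjoinRoot f}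
    (hg : ActsAs hm o g x) (j : ℕ) : ActsAs hm o (g ^ j) (x ^ j) := by
  induction j with
  | zero =>
    rw [pow_zero, pow_zero]
    exact ActsAs.one
  | succ j ih =>
    rw [pow_succ, pow_succ]
    exact ih.mul hg

theorem ActsAs.inv {n o : ℕ} {g : GL (Fin n) K} {x y : AdjoinRoot f}
    (hg : ActsAs hm o (g : Matrix (Fin n) (Fin n) K) x) (hxy : x * y = 1) :
    ActsAs hm o ((g⁻¹ : GL (Fin n) K) : Matrix (Fin n) (Fin n) K) y where
  unitVec_vecMul b hb := by
    have := congrArg (· ᵥ* ((g⁻¹ : GL (Fin n) K) : Matrix (Fin n) (Fin n) K))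
      (hg.unitVec_vecMul b hb)
    simpa only [vecMul_vecMul, Units.mul_inv, vecMul_one, eq_comm] using this
  blockVec_vecMul u := by
    have := congrArg (· ᵥ* ((g⁻¹ : GL (Fin n) K) : Matrix (Fin n) (Fin n) K))
      (hg.blockVec_vecMul (y * u))
    rw [← mul_assoc, hxy, one_mul] at this
    simpa only [vecMul_vecMul, Units.mul_inv, vecMul_one, eq_comm] using this

/-- The image contains every unit vector. This shows that the generating set of G_i is nonempty, its
elements being required to lie in GL_n. -/
theorem ActsAs.isUnit {n o : ℕ} (hf : Irreducible f) (hn : n = o + f.natDegree)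
    {g : Matrix (Fin n) (Fin n) K} {x : AdjoinRoot f} (hg : ActsAs hm o g x) (hx : x ≠ 0) :
    IsUnit g := by
  rw [← vecMul_surjective_iff_isUnit]
  have h : LinearMap.range g.vecMulLinear = ⊤ := by
    refine eq_top_of_unitVec_mem fun b hb => ?_
    rcases lt_or_ge b o with h1 | h1
    · exact ⟨_, hg.unitVec_vecMul b h1⟩
    · refine unitVec_mem_of_blockVec_mem hm hn
        (blockVec_mem_of_root_pow_mul hm hf hx fun a _ =>
          ⟨blockVec hm n o (AdjoinRoot.root f ^ a), ?_⟩) h1 hb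
      rw [vecMulLinear_apply, hg.blockVec_vecMul, mul_comm]
  exact LinearMap.range_eq_top.1 h

/-- Row a of the companion matrix is the coordinate vector of α^(a+1), with the reduction modulo f
appearing in the last row. -/
theorem actsAs_blockDiag_companion {s k h i : ℕ} (hi : i < s) (hd : f.natDegree = i * k + h) :
    ActsAs hm ((s - i - 1) * k + k) (blockDiag s k h i hi (companion f (i * k + h)))
      (AdjoinRoot.root f) where
  unitVec_vecMul b hb := by
    have := dim_split s k h i hi
    rw [FlagCode.unitVec_vecMul _ (by omega), blockDiag_apply_of_lt hi _ hb]
  blockVec_vecMul y := by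
    have hdim := dim_split s k h i hi
    set o := (s - i - 1) * k + k with ho
    let M := blockDiag s k h i hi (companion f (i * k + h))
    suffices h1 : M.vecMulLinear ∘ₗ blockVec hm (s * k + h) o =
        blockVec hm (s * k + h) o ∘ₗ LinearMap.mulLeft K (AdjoinRoot.root f) from
      LinearMap.congr_fun h1 y
    refine root_pow_linearMap_ext hm fun a ha => ?_
    rw [LinearMap.comp_apply, LinearMap.comp_apply, LinearMap.mulLeft_apply, ← pow_succ',
      blockVec_root_pow hm ha, vecMulLinear_apply,
      FlagCode.unitVec_vecMul _ (show o + a < s * k + h by omega)]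
    ext c
    rw [show M ⟨o + a, _⟩ c = _ from blockDiag_apply_of_le hi _ ⟨a, by omega⟩ rfl c]
    simp only [← ho]
    by_cases hc : o ≤ (c : ℕ)
    · rw [dif_pos hc, companion, of_apply]
      by_cases ha' : a + 1 < f.natDegree
      · rw [blockVec_root_pow hm ha', if_pos (by simpa [← hd] using ha'), unitVec]
        refine if_congr ?_ rfl rfl
        simp only
        omega
      · rw [if_neg (by simpa [← hd] using ha'), show a + 1 = f.natDegree by omega,
          blockVec_apply, if_pos hc, modByMonicHom_root_pow_natDegree, coeff_sub, coeff_X_pow,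
          if_neg (by omega), zero_sub]
    · rw [dif_neg hc, blockVec_apply, if_neg hc]

theorem exists_actsAs_of_mem_groupG (hf : Irreducible f) {s k h i : ℕ} (hi : i < s)
    (hd : f.natDegree = i * k + h) (hroot : AdjoinRoot.root f ≠ 0)
    {g : GL (Fin (s * k + h)) K} (hg : g ∈ groupG s k h i hi f) :
    ∃ x : AdjoinRoot f, x ≠ 0 ∧
      ActsAs hm ((s - i - 1) * k + k) (g : Matrix (Fin (s * k + h)) (Fin (s * k + h)) K) x := by
  have := Fact.mk hf
  refine Subgroup.closure_induction (p := fun (g : GL (Fin (s * k + h)) K) _ => ∃ x : AdjoinRoot f, x ≠ 0 ∧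
      ActsAs hm ((s - i - 1) * k + k) (g : Matrix (Fin (s * k + h)) (Fin (s * k + h)) K) x)
    ?_ ?_ ?_ ?_ hg
  · intro g hg
    refine ⟨_, hroot, ?_⟩
    rw [show (g : Matrix (Fin (s * k + h)) (Fin (s * k + h)) K) = _ from hg]
    exact actsAs_blockDiag_companion hi hd
  · exact ⟨1, one_ne_zero, ActsAs.one⟩
  · rintro g g' _ _ ⟨x, hx, hg⟩ ⟨x', hx', hg'⟩
    exact ⟨x * x', mul_ne_zero hx hx', hg.mul hg'⟩
  · rintro g _ ⟨x, hx, hg⟩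
    exact ⟨x⁻¹, inv_ne_zero hx, hg.inv (mul_inv_cancel₀ hx)⟩

theorem card_adjoinRoot [Finite K] (hm : f.Monic) :
    Nat.card (AdjoinRoot f) = Nat.card K ^ f.natDegree := by
  have := hm.finite_adjoinRoot
  rw [Module.natCard_eq_pow_finrank (K := K), (AdjoinRoot.powerBasis' hm).finrank,
    AdjoinRoot.powerBasis'_dim]

/-- No positive power of 0 is 1, so `orderOf` would return 0, whereas q^m - 1 is positive. -/
theorem IsPrimitivePolynomial.root_ne_zero [Finite K] {m : ℕ} (hf : IsPrimitivePolynomial f m)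
    (hm : 0 < m) : AdjoinRoot.root f ≠ 0 := by
  have := Fact.mk hf.2.1
  intro h
  have h1 := hf.2.2.2
  rw [h, orderOf_eq_zero_iff'.2 fun j hj => by simp [hj.ne']] at h1
  have := Nat.one_lt_pow hm.ne' (Finite.one_lt_card (α := K))
  omega

/-- The order of the root equals the number of units of the field, so the root generates them all.
-/
theorem IsPrimitivePolynomial.exists_pow_eq [Finite K] {m : ℕ} (hf : IsPrimitivePolynomial f m)
    (hm : 0 < m) {x : AdjoinRoot f} (hx : x ≠ 0) : ∃ j : ℕ, AdjoinRoot.root f ^ j = x := by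
  have := Fact.mk hf.2.1
  have := hf.1.finite_adjoinRoot
  have : Finite (AdjoinRoot f) := Module.finite_of_finite K
  have h1 : orderOf (Units.mk0 _ (hf.root_ne_zero hm)) = Nat.card (AdjoinRoot f)ˣ := by
    rw [← orderOf_units, Units.val_mk0, hf.2.2.2, Nat.card_units, card_adjoinRoot hf.1, hf.2.2.1]
  have h2 : Subgroup.zpowers (Units.mk0 _ (hf.root_ne_zero hm)) = ⊤ := by
    rw [← Subgroup.card_eq_iff_eq_top, Nat.card_zpowers, h1]
  have h3 : Units.mk0 x hx ∈ Subgroup.zpowers (Units.mk0 _ (hf.root_ne_zero hm)) := by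
    rw [h2]
    exact Subgroup.mem_top _
  rw [← mem_powers_iff_mem_zpowers] at h3
  obtain ⟨j, hj⟩ := h3
  exact ⟨j, by simpa using congrArg Units.val hj⟩

theorem exists_mem_groupG_actsAs [Finite K] {s k h i : ℕ} (hi : i < s)
    (hf : IsPrimitivePolynomial f (i * k + h)) (hpos : 0 < i * k + h) (hm : f.Monic)
    {x : AdjoinRoot f} (hx : x ≠ 0) :
    ∃ g ∈ groupG s k h i hi f,
      ActsAs hm ((s - i - 1) * k + k) (g : Matrix (Fin (s * k + h)) (Fin (s * k + h)) K) x := by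
  obtain ⟨j, rfl⟩ := hf.exists_pow_eq hpos hx
  have h1 : ActsAs hm ((s - i - 1) * k + k) (blockDiag s k h i hi (companion f (i * k + h)))
    (AdjoinRoot.root f) := actsAs_blockDiag_companion hi hf.2.2.1
  obtain ⟨u, hu⟩ := h1.isUnit hf.2.1 (by rw [hf.2.2.1, dim_split s k h i hi])
    (hf.root_ne_zero hpos)
  have hmem : u ∈ groupG s k h i hi f := Subgroup.subset_closure hu
  refine ⟨u ^ j, pow_mem hmem j, ?_⟩
  rw [Units.val_pow_eq_pow_val, hu]
  exact h1.pow j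

theorem zeroToOne_one (hf : Irreducible f) : zeroToOne (1 : AdjoinRoot f) = 1 := by
  have := Fact.mk hf
  exact zeroToOne_of_ne one_ne_zero

/-- The matrix A_i has the label 1, and g moves it to the label x, since the unit vectors before the
field block are fixed. -/
theorem codeRow_one_vecMul {n k z : ℕ} (hf : Irreducible f) {g : Matrix (Fin n) (Fin n) K}
    {x : AdjoinRoot f} (hx : x ≠ 0) (hg : ActsAs hm (z + k) g x) (a : ℕ) :
    codeRow hm n k z 1 a ᵥ* g = codeRow hm n k z x a := by
  rw [codeRow, codeRow, zeroToOne_one hf, zeroToOne_of_ne hx, mul_one, mul_one]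
  split_ifs
  · rw [add_vecMul, hg.unitVec_vecMul _ (by omega), hg.blockVec_vecMul, mul_comm]
  · rw [hg.blockVec_vecMul, mul_comm]
  · rw [hg.unitVec_vecMul _ (by omega)]
  · rw [hg.blockVec_vecMul, mul_comm]

theorem matA_eq (hm : f.Monic) (hf : Irreducible f) {s k h i : ℕ} (hi : i < s) (hi' : 1 ≤ i)
    (hd : f.natDegree = i * k + h) :
    matA K s k h i = of fun a : Fin (s * k + h - 1) =>
      codeRow hm (s * k + h) k ((s - i - 1) * k) 1 a := by
  have hdim := dim_split s k h i hi
  have hkd : k ≤ i * k := Nat.le_mul_of_pos_left k hi'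
  ext a b
  have ha := a.2
  rw [of_apply, matA, of_apply, codeRow, zeroToOne_one hf, hd, mul_one, mul_one]
  split_ifs with h1 h2 h3 h4 h5 h6 h7
  · rw [blockVec_root_pow hm (by omega)]
    rcases h2 with h2 | h2
    · rw [Pi.add_apply, unitVec, unitVec, if_pos h2, if_neg (by omega), add_zero]
    · rw [Pi.add_apply, unitVec, unitVec, if_neg (by omega), if_pos h2, zero_add]
  · rw [blockVec_root_pow hm (by omega), Pi.add_apply, unitVec, unitVec, if_neg (by tauto),
      if_neg (by tauto), add_zero]
  · rw [blockVec_root_pow hm (by omega), unitVec, if_pos h4]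
  · rw [blockVec_root_pow hm (by omega), unitVec, if_neg h4]
  · rw [unitVec, if_pos h6]
  · rw [unitVec, if_neg h6]
  · rw [blockVec_root_pow hm (by omega), unitVec, if_pos h7]
  · rw [blockVec_root_pow hm (by omega), unitVec, if_neg h7]

theorem matB_eq (hm : f.Monic) {s k h i : ℕ} (hi : i < s) (hi' : 1 ≤ i)
    (hd : f.natDegree = i * k + h) :
    matB K s k h i = of fun a : Fin (s * k + h - 1) =>
      codeRow hm (s * k + h) k ((s - i - 1) * k) 0 a := by
  have hdim := dim_split s k h i hi
  have hkd : k ≤ i * k := Nat.le_mul_of_pos_left k hi'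
  ext a b
  have ha := a.2
  rw [of_apply, matB, of_apply, codeRow, zeroToOne_zero, hd, mul_one, mul_one, mul_zero, map_zero,
    add_zero]
  split_ifs with h1 h2 h3 h4 h5 h6 h7
  · rw [unitVec, if_pos h2]
  · rw [unitVec, if_neg h2]
  · rw [blockVec_root_pow hm (by omega), unitVec, if_pos h4]
  · rw [blockVec_root_pow hm (by omega), unitVec, if_neg h4]
  · rw [unitVec, if_pos h6]
  · rw [unitVec, if_neg h6]
  · rw [blockVec_root_pow hm (by omega), unitVec, if_pos h7]
  · rw [blockVec_root_pow hm (by omega), unitVec, if_neg h7]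

theorem matA_mul_eq (hf : Irreducible f) {s k h i : ℕ} (hi : i < s) (hi' : 1 ≤ i)
    (hd : f.natDegree = i * k + h) {g : Matrix (Fin (s * k + h)) (Fin (s * k + h)) K}
    {x : AdjoinRoot f} (hx : x ≠ 0) (hg : ActsAs hm ((s - i - 1) * k + k) g x) :
    matA K s k h i * g = of fun a : Fin (s * k + h - 1) =>
      codeRow hm (s * k + h) k ((s - i - 1) * k) x a := by
  rw [matA_eq hm hf hi hi' hd]
  ext a b
  rw [mul_apply_eq_vecMul, of_apply, ← codeRow_one_vecMul hf hx hg]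
  rfl

theorem matM_eq (s k h : ℕ) :
    matM K s k h = of fun a : Fin (s * k + h - 1) => unitVec K (s * k + h) (s * k + h - 1 - a) := by
  ext a b
  have ha := a.2
  have hb := b.2
  rw [matM, of_apply, of_apply, unitVec]
  refine if_congr ?_ rfl rfl
  omega

end CyclicGroup

/-! ### Labelling the codewords and comparing any two of them -/

section Labels

open Polynomial Matrix

/-- The dimension of the sum of two components of dimension `t` of distinct codewords is at least
`minSupDim k h t`. -/
def minSupDim (k h t : ℕ) : ℕ :=
  if t = 2 * k + h then 2 * k + 2 * h else min t (3 * k + h) + min t k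

variable {K : Type*} [Field K]

section Pairs

variable {f f' : Polynomial K} (hm : f.Monic) (hm' : f'.Monic) {k h z z' t : ℕ}

theorem minSupDim_le_codeSpan_same (hf : Irreducible f) (hh : h < k)
    (hn : 4 * k + h = z + k + f.natDegree) (hkd : k ≤ f.natDegree) {x x' : AdjoinRoot f}
    (hne : x ≠ x') (t : ℕ) :
    minSupDim k h t ≤ Module.finrank K (codeSpan hm (4 * k + h) k z x t ⊔
      codeSpan hm (4 * k + h) k z x' t : Submodule K (Fin (4 * k + h) → K)) := by
  refine le_trans ?_ (le_finrank_sup_codeSpan_same hm hf hn hkd hne t)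
  rw [minSupDim]
  split_ifs <;> omega

/-- As long as t ≤ deg f + z', the first span vanishes on the head columns of the second. For t ≥ 3k
+ h the sum is everything. The hypothesis `hc` says that a dimension escapes both arguments only for
i = 1, i' = 3. -/
theorem minSupDim_le_codeSpan (hf : Irreducible f) (hf' : Irreducible f') (hh : h < k)
    (hn : 4 * k + h = z + k + f.natDegree) (hn' : 4 * k + h = z' + k + f'.natDegree)
    (hkd : k + h ≤ f.natDegree) (hz : z' + k ≤ z)
    (hc : 2 * k + h ≤ f.natDegree + z' ∨ (z = 2 * k ∧ z' = 0)) (x : AdjoinRoot f)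
    (x' : AdjoinRoot f') (ht : t ≤ k + h ∨ t = 2 * k + h ∨ 3 * k + h ≤ t) (htn : t < 4 * k + h) :
    minSupDim k h t ≤ Module.finrank K (codeSpan hm (4 * k + h) k z x t ⊔
      codeSpan hm' (4 * k + h) k z' x' t : Submodule K (Fin (4 * k + h) → K)) := by
  rcases le_or_gt (3 * k + h) t with h1 | h1
  · rw [codeSpan_sup_codeSpan_eq_top hm hm' hf hf' (by omega) hn hn' hz x x' (by omega),
      finrank_top, Module.finrank_fin_fun, minSupDim]
    split_ifs <;> omega
  · by_cases h2 : t ≤ f.natDegree + z'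
    · have h3 := le_finrank_sup_codeSpan_of_vanish hm' (S := codeSpan hm (4 * k + h) k z x t) hn'
        (fun c hc hc' => codeSpan_apply_eq_zero hm x (by omega) (by omega)) x' t
      rw [finrank_codeSpan hm hf hn (by omega) (by omega) x (by omega)] at h3
      refine le_trans ?_ h3
      rw [minSupDim]
      split_ifs <;> omega
    · obtain ⟨rfl, rfl⟩ := hc.resolve_left (by omega)
      obtain rfl : t = 2 * k + h := by omega
      rw [minSupDim, if_pos rfl]
      by_cases hx : x = 0 ∧ x' = 0
      · obtain ⟨rfl, rfl⟩ := hx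
        exact (finrank_sup_codeSpan_zero hm hm' (by omega) (by omega) rfl hh).ge
      · have h3 := le_finrank_sup_codeSpan_one_three hm hm' (k := k) (h := h) hf hf' (by omega)
          (by omega) rfl (x := x) (x' := x') (by tauto)
        omega

theorem minSupDim_le_antidiagSpan (hf : Irreducible f) (hh : h < k)
    (hn : 4 * k + h = z + k + f.natDegree) (hkd : k ≤ f.natDegree)
    (hz : z = 0 ∨ z = k ∨ z = 2 * k) (x : AdjoinRoot f)
    (ht : t ≤ k + h ∨ t = 2 * k + h ∨ 3 * k + h ≤ t) (htn : t < 4 * k + h) :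
    minSupDim k h t ≤ Module.finrank K (antidiagSpan K (4 * k + h) t ⊔
      codeSpan hm (4 * k + h) k z x t : Submodule K (Fin (4 * k + h) → K)) := by
  have hM := finrank_antidiagSpan (K := K) (n := 4 * k + h) (t := t) (by omega)
  rcases le_or_gt (3 * k + h) t with h1 | h1
  · rw [antidiagSpan_sup_codeSpan_eq_top hm hf hkd (by omega) hn x (by omega) (by omega),
      finrank_top, Module.finrank_fin_fun, minSupDim]
    split_ifs <;> omega
  · by_cases h2 : z + k + t ≤ 4 * k + h
    · have h3 := le_finrank_sup_codeSpan_of_vanish hm (S := antidiagSpan K (4 * k + h) t) hn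
        (fun c hc hc' => antidiagSpan_apply_eq_zero (by omega)) x t
      rw [hM] at h3
      refine le_trans ?_ h3
      rw [minSupDim]
      split_ifs <;> omega
    -- Here z = 2k and t = 2k + h: M reaches the head columns but not the first k columns, which the
    -- block I_z supplies.
    · have h3 := le_finrank_sup_codeSpan_of_vanish_first hm (S := antidiagSpan K (4 * k + h) t) hn
        hkd (by omega) (fun c hc => antidiagSpan_apply_eq_zero (by omega)) x (t := t) (by omega)
      rw [hM] at h3
      refine le_trans ?_ h3
      rw [minSupDim]
      split_ifs <;> omega

end Pairs

variable {f : ℕ → Polynomial K} {k h : ℕ}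

/-- The labels of the codewords: `none` stands for `M`, and `(i, x)` for `A_{i+1} g` where `g` acts
as multiplication by `x`, if `x ≠ 0`, and for `B_{i+1}`, if `x = 0`. -/
abbrev Label (f : ℕ → Polynomial K) : Type _ := Option (Σ i : Fin 3, AdjoinRoot (f (i + 1)))

/-- The rows of the matrix with label `w`. -/
noncomputable def labelRow (k h : ℕ) (hm : ∀ i : Fin 3, (f (i + 1)).Monic) :
    Label f → ℕ → Fin (4 * k + h) → K
  | none => fun a => unitVec K (4 * k + h) (4 * k + h - 1 - a)
  | some w => codeRow (hm w.1) (4 * k + h) k ((4 - (w.1 + 1) - 1) * k) w.2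

/-- The span of the first `t` rows of the matrix with label `w`. -/
noncomputable def labelSpan (k h : ℕ) (hm : ∀ i : Fin 3, (f (i + 1)).Monic) (w : Label f)
    (t : ℕ) : Submodule K (Fin (4 * k + h) → K) :=
  rowsSpan (labelRow k h hm w) t

variable (hm : ∀ i : Fin 3, (f (i + 1)).Monic)

/-- A single family of rows covers A_i g, B_i and M. That every nonzero label occurs is where
primitivity, beyond irreducibility, enters. -/
theorem generatorMatrices_eq_range [Finite K] (hk : h < k)
    (hf : ∀ i, 1 ≤ i → i ≤ 3 → IsPrimitivePolynomial (f i) (i * k + h)) :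
    generatorMatrices 4 k h f =
      Set.range fun w => of fun a : Fin (4 * k + h - 1) => labelRow k h hm w a := by
  have hpos : ∀ i, 1 ≤ i → 0 < i * k + h := fun i hi => by
    have := Nat.le_mul_of_pos_left k hi
    omega
  ext W
  constructor
  · rintro (⟨i, hi1, hi, g, hg, rfl⟩ | ⟨i, hi1, hi, rfl⟩ | rfl)
    · have hfi := hf i hi1 (by omega)
      obtain ⟨i, rfl⟩ := Nat.exists_eq_add_of_le' hi1
      obtain ⟨x, hx, hgx⟩ := exists_actsAs_of_mem_groupG (hm := hm ⟨i, by omega⟩) hfi.2.1 hi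
        hfi.2.2.1 (hfi.root_ne_zero (hpos _ hi1)) hg
      exact ⟨some ⟨⟨i, by omega⟩, x⟩, (matA_mul_eq hfi.2.1 hi hi1 hfi.2.2.1 hx hgx).symm⟩
    · have hfi := hf i hi1 (by omega)
      obtain ⟨i, rfl⟩ := Nat.exists_eq_add_of_le' hi1
      exact ⟨some ⟨⟨i, by omega⟩, 0⟩, (matB_eq (hm ⟨i, by omega⟩) hi hi1 hfi.2.2.1).symm⟩
    · exact ⟨none, (matM_eq 4 k h).symm⟩
  · rintro ⟨_ | ⟨i, x⟩, rfl⟩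
    · exact Or.inr (Or.inr (matM_eq 4 k h).symm)
    · have hi := i.2
      have hfi := hf (i + 1) (by omega) (by omega)
      by_cases hx : x = 0
      · subst hx
        exact Or.inr (Or.inl ⟨i + 1, by omega, by omega,
          (matB_eq (hm i) (by omega) (by omega) hfi.2.2.1).symm⟩)
      · obtain ⟨g, hg, hgx⟩ := exists_mem_groupG_actsAs (s := 4) (by omega) hfi
          (hpos _ (by omega)) (hm i) hx
        exact Or.inl ⟨i + 1, by omega, by omega, g, hg,
          (matA_mul_eq hfi.2.1 (by omega) (by omega) hfi.2.2.1 hx hgx).symm⟩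

theorem finrank_labelSpan (hk : h < k)
    (hf : ∀ i, 1 ≤ i → i ≤ 3 → IsPrimitivePolynomial (f i) (i * k + h)) (w : Label f) {t : ℕ}
    (ht : t < 4 * k + h) : Module.finrank K (labelSpan k h hm w t) = t := by
  rcases w with _ | ⟨i, x⟩
  · exact finrank_antidiagSpan (by omega)
  · have hfi := hf (i + 1) (by omega) (by omega)
    have hd := hfi.2.2.1
    have hdim := dim_split 4 k h (i + 1) (by omega)
    have hkd : k ≤ (i + 1) * k := Nat.le_mul_of_pos_left k (by omega)
    exact finrank_codeSpan (z := (4 - (i + 1) - 1) * k) (hm i) hfi.2.1 (by omega) (by omega) (by omega) x (by omega)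

theorem minSupDim_le_of_lt (hk : h < k)
    (hf : ∀ i, 1 ≤ i → i ≤ 3 → IsPrimitivePolynomial (f i) (i * k + h)) {i i' : Fin 3}
    (hi : i < i') (x : AdjoinRoot (f (i + 1))) (x' : AdjoinRoot (f (i' + 1))) {t : ℕ}
    (ht : t ≤ k + h ∨ t = 2 * k + h ∨ 3 * k + h ≤ t) (htn : t < 4 * k + h) :
    minSupDim k h t ≤ Module.finrank K (labelSpan k h hm (some ⟨i, x⟩) t ⊔
      labelSpan k h hm (some ⟨i', x'⟩) t : Submodule K (Fin (4 * k + h) → K)) := by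
  have hfi := hf (i + 1) (by omega) (by omega)
  have hd := hfi.2.2.1
  have hdim := dim_split 4 k h (i + 1) (by omega)
  have hfi' := hf (i' + 1) (by omega) (by omega)
  have hd' := hfi'.2.2.1
  have hdim' := dim_split 4 k h (i' + 1) (by omega)
  have hc : ((i : ℕ) = 0 ∧ (i' : ℕ) = 1) ∨ ((i : ℕ) = 0 ∧ (i' : ℕ) = 2) ∨
    ((i : ℕ) = 1 ∧ (i' : ℕ) = 2) := by omega
  have hkd : k ≤ (i + 1) * k := Nat.le_mul_of_pos_left k (by omega)
  refine minSupDim_le_codeSpan (z := (4 - (i + 1) - 1) * k) (z' := (4 - (i' + 1) - 1) * k)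
    (hm i) (hm i') hfi.2.1 hfi'.2.1 hk (by omega) (by omega) (by omega) ?_ ?_ x x' ht htn
  · rw [← Nat.succ_mul]
    exact Nat.mul_le_mul_right k (by omega)
  · rw [hd]
    rcases hc with ⟨h1, h2⟩ | ⟨h1, h2⟩ | ⟨h1, h2⟩ <;> rw [h1, h2]
    · exact Or.inl (by omega)
    · exact Or.inr ⟨rfl, Nat.zero_mul k⟩
    · exact Or.inl (by omega)

theorem minSupDim_le_labelSpan (hk : h < k)
    (hf : ∀ i, 1 ≤ i → i ≤ 3 → IsPrimitivePolynomial (f i) (i * k + h)) {w w' : Label f}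
    (hw : w ≠ w') {t : ℕ} (ht : t ≤ k + h ∨ t = 2 * k + h ∨ 3 * k + h ≤ t)
    (htn : t < 4 * k + h) :
    minSupDim k h t ≤ Module.finrank K (labelSpan k h hm w t ⊔ labelSpan k h hm w' t :
      Submodule K (Fin (4 * k + h) → K)) := by
  have hnone : ∀ (i : Fin 3) (x : AdjoinRoot (f (i + 1))), minSupDim k h t ≤
      Module.finrank K (labelSpan k h hm none t ⊔ labelSpan k h hm (some ⟨i, x⟩) t :
      Submodule K (Fin (4 * k + h) → K)) := by
    intro i x
    have hfi := hf (i + 1) (by omega) (by omega)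
    have hd := hfi.2.2.1
    have hdim := dim_split 4 k h (i + 1) (by omega)
    have hkd : k ≤ (i + 1) * k := Nat.le_mul_of_pos_left k (by omega)
    refine minSupDim_le_antidiagSpan (z := (4 - (i + 1) - 1) * k) (hm i) hfi.2.1 hk (by omega) (by omega) ?_ x ht htn
    have hc : (i : ℕ) = 0 ∨ (i : ℕ) = 1 ∨ (i : ℕ) = 2 := by omega
    rcases hc with h1 | h1 | h1 <;> rw [h1] <;> omega
  rcases w with _ | ⟨i, x⟩ <;> rcases w' with _ | ⟨i', x'⟩
  · exact absurd rfl hw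
  · exact hnone i' x'
  · rw [sup_comm]
    exact hnone i x
  · rcases lt_trichotomy i i' with hi | rfl | hi
    · exact minSupDim_le_of_lt hm hk hf hi x x' ht htn
    · have hfi := hf (i + 1) (by omega) (by omega)
      have hd := hfi.2.2.1
      have hdim := dim_split 4 k h (i + 1) (by omega)
      have hkd : k ≤ (i + 1) * k := Nat.le_mul_of_pos_left k (by omega)
      have hx : x ≠ x' := fun hx => hw (by rw [hx])
      exact minSupDim_le_codeSpan_same (z := (4 - (i + 1) - 1) * k) (hm i) hfi.2.1 hk (by omega)
        (by omega) hx t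
    · rw [sup_comm]
      exact minSupDim_le_of_lt hm hk hf hi x' x ht htn

/-- Equal components would have a sum of dimension t, below the bound `minSupDim`; at t = 2k + h
that bound exceeds t only when h ≥ 1. -/
theorem labelSpan_injective (hk : h < k)
    (hf : ∀ i, 1 ≤ i → i ≤ 3 → IsPrimitivePolynomial (f i) (i * k + h)) {t : ℕ} (ht1 : 1 ≤ t)
    (ht : t ≤ k + h ∨ t = 2 * k + h ∧ 1 ≤ h ∨ 3 * k + h ≤ t) (htn : t < 4 * k + h) :
    Function.Injective fun w => labelSpan k h hm w t := by
  intro w w' heq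
  by_contra hw
  have h1 := minSupDim_le_labelSpan hm hk hf hw (t := t) (by tauto) htn
  rw [show labelSpan k h hm w t = labelSpan k h hm w' t from heq, sup_idem,
    finrank_labelSpan hm hk hf w' htn, minSupDim] at h1
  split_ifs at h1 <;> omega

theorem card_label [Finite K]
    (hf : ∀ i, 1 ≤ i → i ≤ 3 → IsPrimitivePolynomial (f i) (i * k + h)) :
    Nat.card (Label f) = (∑ i ∈ Finset.Icc 1 3, Nat.card K ^ (i * k + h)) + 1 := by
  have hcard : ∀ i : Fin 3, Nat.card (AdjoinRoot (f (i + 1))) = Nat.card K ^ ((i + 1) * k + h) := by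
    intro i
    have hfi := hf (i + 1) (by omega) (by omega)
    rw [card_adjoinRoot hfi.1, hfi.2.2.1]
  have hfin : ∀ i : Fin 3, Finite (AdjoinRoot (f (i + 1))) := by
    intro i
    have hfi := hf (i + 1) (by omega) (by omega)
    have := hfi.1.finite_adjoinRoot
    exact Module.finite_of_finite K
  rw [Finite.card_option, Nat.card_sigma, Finset.sum_congr rfl fun i _ => hcard i,
    Fin.sum_univ_eq_sum_range (fun i => Nat.card K ^ ((i + 1) * k + h)) 3,
    Finset.range_eq_Ico, Finset.sum_Ico_add' (fun i => Nat.card K ^ (i * k + h)) 0 3 1]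
  rfl

/-! ### The type vector and the flag distance -/

theorem longType_cases (hk : h < k) (j : Fin (k + h + 1 + k)) :
    1 ≤ longType k h j ∧ longType k h j < 4 * k + h ∧
      (longType k h j ≤ k + h ∨ longType k h j = 2 * k + h ∨ 3 * k + h ≤ longType k h j) := by
  have hj := j.2
  simp only [longType]
  split_ifs <;> omega

theorem longType_strictMono (hk : h < k) : StrictMono (longType k h) := by
  intro j j' hj
  have hj1 := j'.2
  have hj2 : (j : ℕ) < j' := hj
  simp only [longType]
  split_ifs <;> omega

/-- The index set splits as k + h + 1 + k. The contributions are 2, 4, ..., 2k, then h times 2k,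
then 2h, then 2k, ..., 4, 2; the outer groups pair up termwise to 2(k+1). -/
theorem sum_minSupDim_sub (hk : h < k) :
    ∑ j, 2 * (minSupDim k h (longType k h j) - longType k h j) =
      2 * k * (k + h + 1) + 2 * h := by
  rw [Fin.sum_univ_add, Fin.sum_univ_castSucc, Fin.sum_univ_add]
  have h1 : ∀ j : Fin k, 2 * (minSupDim k h (longType k h ((j.castAdd h).castSucc.castAdd k)) -
      longType k h ((j.castAdd h).castSucc.castAdd k)) = 2 * (j + 1) := by
    intro j
    have hj := j.2
    simp only [longType, minSupDim, Fin.val_castAdd, Fin.val_castSucc]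
    split_ifs <;> omega
  have h2 : ∀ j : Fin h, 2 * (minSupDim k h (longType k h ((j.natAdd k).castSucc.castAdd k)) -
      longType k h ((j.natAdd k).castSucc.castAdd k)) = 2 * k := by
    intro j
    have hj := j.2
    simp only [longType, minSupDim, Fin.val_castAdd, Fin.val_castSucc, Fin.val_natAdd]
    split_ifs <;> omega
  have h3 : 2 * (minSupDim k h (longType k h ((Fin.last (k + h)).castAdd k)) -
      longType k h ((Fin.last (k + h)).castAdd k)) = 2 * h := by
    simp only [longType, minSupDim, Fin.val_castAdd, Fin.val_last]
    split_ifs <;> omega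
  have h4 : ∀ j : Fin k, 2 * (minSupDim k h (longType k h (j.natAdd (k + h + 1))) -
      longType k h (j.natAdd (k + h + 1))) = 2 * (k - j) := by
    intro j
    have hj := j.2
    simp only [longType, minSupDim, Fin.val_natAdd]
    split_ifs <;> omega
  have h5 : (∑ j : Fin k, 2 * ((j : ℕ) + 1)) + ∑ j : Fin k, 2 * (k - (j : ℕ)) =
      k * (2 * (k + 1)) := by
    have h6 : ∀ j : Fin k, 2 * ((j : ℕ) + 1) + 2 * (k - (j : ℕ)) = 2 * (k + 1) := fun j => by
      have := j.2
      omega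
    rw [← Finset.sum_add_distrib, Finset.sum_congr rfl fun j _ => h6 j]
    simp
  simp only [h1, h2, h3, h4, Finset.sum_const, Finset.card_univ, Fintype.card_fin, smul_eq_mul]
  linarith

theorem subspaceDist_labelSpan (hk : h < k)
    (hf : ∀ i, 1 ≤ i → i ≤ 3 → IsPrimitivePolynomial (f i) (i * k + h)) (w w' : Label f) {t : ℕ}
    (ht : t < 4 * k + h) :
    subspaceDist (labelSpan k h hm w t) (labelSpan k h hm w' t) =
      2 * (Module.finrank K (labelSpan k h hm w t ⊔ labelSpan k h hm w' t :
        Submodule K (Fin (4 * k + h) → K)) - t) :=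
  subspaceDist_eq (finrank_labelSpan hm hk hf w ht) (finrank_labelSpan hm hk hf w' ht)

theorem le_flagDist_labelSpan (hk : h < k)
    (hf : ∀ i, 1 ≤ i → i ≤ 3 → IsPrimitivePolynomial (f i) (i * k + h)) {w w' : Label f}
    (hw : w ≠ w') :
    2 * k * (k + h + 1) + 2 * h ≤
      flagDist (fun j => labelSpan k h hm w (longType k h j))
        (fun j => labelSpan k h hm w' (longType k h j)) := by
  rw [← sum_minSupDim_sub hk, flagDist]
  refine Finset.sum_le_sum fun j _ => ?_
  obtain ⟨-, h2, h3⟩ := longType_cases hk j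
  rw [subspaceDist_labelSpan hm hk hf w w' h2]
  have := minSupDim_le_labelSpan hm hk hf hw h3 h2
  omega

/-- The pair B_1, B_3 attains all the bounds simultaneously, so the termwise minimum is the distance
of an actual pair. -/
theorem finrank_sup_labelSpan_zero (hk : h < k)
    (hf : ∀ i, 1 ≤ i → i ≤ 3 → IsPrimitivePolynomial (f i) (i * k + h)) {t : ℕ}
    (ht : t ≤ k + h ∨ t = 2 * k + h ∨ 3 * k + h ≤ t) (htn : t < 4 * k + h) :
    Module.finrank K (labelSpan k h hm (some ⟨0, 0⟩) t ⊔ labelSpan k h hm (some ⟨2, 0⟩) t :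
      Submodule K (Fin (4 * k + h) → K)) = minSupDim k h t := by
  refine le_antisymm ?_ (minSupDim_le_of_lt hm hk hf (by decide) 0 0 ht htn)
  have hd : (f ((0 : Fin 3) + 1)).natDegree = k + h := by
    have := (hf 1 le_rfl (by omega)).2.2.1
    rwa [one_mul] at this
  have hd' : (f ((2 : Fin 3) + 1)).natDegree = 3 * k + h := (hf 3 (by omega) le_rfl).2.2.1
  have e1 : labelSpan k h hm (some ⟨0, 0⟩) t = codeSpan (hm 0) (4 * k + h) k (2 * k) 0 t := rfl
  have e2 : labelSpan k h hm (some ⟨2, 0⟩) t = codeSpan (hm 2) (4 * k + h) k 0 0 t := by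
    -- The offset for i = 3 evaluates to `0 * k`, which is not `0` by definition when `k` is a
    -- variable.
    conv_rhs => rw [← zero_mul k]
    rfl
  rw [e1, e2]
  rcases ht with h1 | rfl | h1
  · refine (finrank_sup_codeSpan_zero_le (hm 0) (hm 2) hd hd' hk h1).trans ?_
    rw [minSupDim]
    split_ifs <;> omega
  · rw [finrank_sup_codeSpan_zero (hm 0) (hm 2) hd hd' rfl hk, minSupDim, if_pos rfl]
  · refine (Submodule.finrank_le _).trans ?_
    rw [Module.finrank_fin_fun, minSupDim]
    split_ifs <;> omega

theorem flagDist_labelSpan_zero (hk : h < k)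
    (hf : ∀ i, 1 ≤ i → i ≤ 3 → IsPrimitivePolynomial (f i) (i * k + h)) :
    flagDist (fun j => labelSpan k h hm (some ⟨0, 0⟩) (longType k h j))
        (fun j => labelSpan k h hm (some ⟨2, 0⟩) (longType k h j)) =
      2 * k * (k + h + 1) + 2 * h := by
  rw [← sum_minSupDim_sub hk, flagDist]
  refine Finset.sum_congr rfl fun j _ => ?_
  obtain ⟨-, h2, h3⟩ := longType_cases hk j
  rw [subspaceDist_labelSpan hm hk hf _ _ h2, finrank_sup_labelSpan_zero hm hk hf h3 h2]

theorem flagCode_eq_range [Finite K] (hk : h < k)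
    (hf : ∀ i, 1 ≤ i → i ≤ 3 → IsPrimitivePolynomial (f i) (i * k + h)) {r : ℕ} {t : Fin r → ℕ}
    (ht : ∀ j, t j < 4 * k + h) :
    flagCode 4 k h f t = Set.range fun w j => labelSpan k h hm w (t j) := by
  rw [flagCode, generatorMatrices_eq_range hm hk hf, ← Set.range_comp]
  congr 1
  funext w j
  exact firstRowsSpace_of _ (by have := ht j; omega)

theorem subspaceCode_eq_range [Finite K] (hk : h < k)
    (hf : ∀ i, 1 ≤ i → i ≤ 3 → IsPrimitivePolynomial (f i) (i * k + h)) :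
    subspaceCode 4 k h f = Set.range fun w => labelSpan k h hm w (4 * k + h - 1) := by
  rw [subspaceCode, generatorMatrices_eq_range hm hk hf, ← Set.range_comp]
  congr 1
  funext w
  exact rowSpace_of _

theorem ncard_range_of_injective {α β : Type*} {φ : α → β} (hφ : Function.Injective φ) :
    (Set.range φ).ncard = Nat.card α := by
  rw [← Set.image_univ, Set.ncard_image_of_injective _ hφ, Set.ncard_univ]

theorem isFlag_labelSpan (hk : h < k)
    (hf : ∀ i, 1 ≤ i → i ≤ 3 → IsPrimitivePolynomial (f i) (i * k + h)) (w : Label f) :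
    IsFlag (longType k h) fun j => labelSpan k h hm w (longType k h j) := by
  have hrank : ∀ j, Module.finrank K (labelSpan k h hm w (longType k h j)) = longType k h j :=
    fun j => finrank_labelSpan hm hk hf w (longType_cases hk j).2.1
  refine ⟨fun j j' hj => ?_, fun j => ?_, fun j => ?_, hrank⟩
  · have hlt := longType_strictMono hk hj
    refine lt_of_le_of_ne (rowsSpan_mono _ hlt.le) fun heq => hlt.ne ?_
    rw [← hrank j, ← hrank j', heq]
  · rw [bot_lt_iff_ne_bot]
    intro heq
    have h1 := hrank j
    rw [heq, finrank_bot] at h1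
    have := (longType_cases hk j).1
    omega
  · rw [lt_top_iff_ne_top]
    intro heq
    have h1 := hrank j
    rw [heq, finrank_top, Module.finrank_fin_fun] at h1
    have := (longType_cases hk j).2.1
    omega

end Labels

end FlagCode

/-! ### The main theorem -/

open FlagCode in
theorem theorem4p6 {K : Type*} [Field K] [Finite K] (k h : ℕ) (hk : h < k)
    (f : ℕ → Polynomial K)
    (hf : ∀ i, 1 ≤ i → i ≤ 3 → FlagCode.IsPrimitivePolynomial (f i) (i * k + h)) :
    (∀ F ∈ FlagCode.flagCode 4 k h f (FlagCode.longType k h),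
      FlagCode.IsFlag (FlagCode.longType k h) F) ∧
    (FlagCode.CardinalityConsistent (FlagCode.flagCode 4 k h f (FlagCode.longType k h)) ↔
      1 ≤ h) ∧
    (∀ j, FlagCode.longType k h j ≠ 2 * k + h →
      (FlagCode.projectedCode (FlagCode.flagCode 4 k h f (FlagCode.longType k h)) j).ncard =
        (FlagCode.flagCode 4 k h f (FlagCode.longType k h)).ncard) ∧
    (FlagCode.flagCode 4 k h f (FlagCode.longType k h)).ncard =
      (∑ i ∈ Finset.Icc 1 3, Nat.card K ^ (i * k + h)) + 1 ∧
    (FlagCode.fullFlagCode 4 k h f).ncard =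
      (∑ i ∈ Finset.Icc 1 3, Nat.card K ^ (i * k + h)) + 1 ∧
    (FlagCode.subspaceCode 4 k h f).ncard =
      (∑ i ∈ Finset.Icc 1 3, Nat.card K ^ (i * k + h)) + 1 ∧
    FlagCode.IsMinDist (FlagCode.flagCode 4 k h f (FlagCode.longType k h))
      (2 * k * (k + h + 1) + 2 * h) ∧
    FlagCode.flagDist (FlagCode.rowsFlag (FlagCode.longType k h) (FlagCode.matB K 4 k h 1))
        (FlagCode.rowsFlag (FlagCode.longType k h) (FlagCode.matB K 4 k h 3)) =
      2 * k * (k + h + 1) + 2 * h := by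
  have hm : ∀ i : Fin 3, (f (i + 1)).Monic := fun i => (hf (i + 1) (by omega) (by omega)).1
  have hlt : ∀ j, longType k h j < 4 * k + h := fun j => (longType_cases hk j).2.1
  have hcode := flagCode_eq_range hm hk hf hlt
  have hinj : Function.Injective fun (w : Label f) j => labelSpan k h hm w (longType k h j) := by
    intro w w' heq
    refine labelSpan_injective hm hk hf le_rfl (t := 1) (by omega) (by omega) ?_
    have := congrFun heq ⟨0, by omega⟩
    simpa [longType, show 0 < k + h by omega] using this
  have hcard : (flagCode 4 k h f (longType k h)).ncard =
      (∑ i ∈ Finset.Icc 1 3, Nat.card K ^ (i * k + h)) + 1 := by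
    rw [hcode, ncard_range_of_injective hinj, card_label hf]
  have hproj : ∀ j, longType k h j ≠ 2 * k + h ∨ 1 ≤ h →
      (projectedCode (flagCode 4 k h f (longType k h)) j).ncard =
        (flagCode 4 k h f (longType k h)).ncard := by
    intro j hj
    obtain ⟨h1, h2, h3⟩ := longType_cases hk j
    have hinj' := labelSpan_injective hm hk hf h1 (by tauto) h2
    rw [hcard, projectedCode, hcode, ← Set.range_comp, ← card_label hf]
    exact ncard_range_of_injective hinj'
  have hB : ∀ i : Fin 3, rowsFlag (longType k h) (matB K 4 k h (i + 1)) =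
      fun j => labelSpan k h hm (some ⟨i, 0⟩) (longType k h j) := by
    intro i
    funext j
    rw [rowsFlag, matB_eq (hm i) (by omega) (by omega)
      (hf (i + 1) (by omega) (by omega)).2.2.1]
    exact firstRowsSpace_of _ (by have := hlt j; omega)
  have hne : (some ⟨0, 0⟩ : Label f) ≠ some ⟨2, 0⟩ := by
    intro heq
    have : (0 : Fin 3) = 2 := congrArg Sigma.fst (Option.some.inj heq)
    exact absurd this (by decide)
  refine ⟨?_, ⟨fun hcc => ?_, fun hh j => hproj j (Or.inr hh)⟩, fun j hj => hproj j (Or.inl hj),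
    hcard, ?_, ?_, ⟨?_, ?_⟩, ?_⟩
  · rw [hcode]
    rintro _ ⟨w, rfl⟩
    exact isFlag_labelSpan hm hk hf w
  · by_contra hh
    obtain rfl : h = 0 := by omega
    -- The component of dimension 2k, where for h = 0 the flags of B_1 and B_3 coincide.
    let j : Fin (k + 0 + 1 + k) := ⟨k, by omega⟩
    have hj : longType k 0 j = 2 * k + 0 := by simp [longType, j]
    -- A nonzero `ncard` forces finiteness, which turns equality of cardinalities into injectivity
    -- of the projection.
    have hfin : (flagCode 4 k 0 f (longType k 0)).Finite := by
      refine Set.finite_of_ncard_ne_zero ?_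
      rw [hcard]
      omega
    have h1 := (Set.ncard_image_iff hfin).1 (hcc j)
    rw [hcode] at h1
    have h2 := finrank_sup_labelSpan_zero hm hk hf (t := 2 * k) (by omega) (by omega)
    rw [minSupDim, if_pos (by omega), mul_zero, Nat.add_zero (2 * k)] at h2
    have h3 : ∀ w : Label f, Module.finrank K (labelSpan k 0 hm w (2 * k)) = 2 * k := fun w =>
      finrank_labelSpan hm hk hf w (by omega)
    -- The sum has the same dimension 2k as each summand, so both summands equal it.
    have h4 := Submodule.eq_of_le_of_finrank_eq
      (le_sup_left : labelSpan k 0 hm (some ⟨0, 0⟩) (2 * k) ≤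
        _ ⊔ labelSpan k 0 hm (some ⟨2, 0⟩) (2 * k)) ((h3 _).trans h2.symm)
    have h5 := Submodule.eq_of_le_of_finrank_eq
      (le_sup_right : labelSpan k 0 hm (some ⟨2, 0⟩) (2 * k) ≤
        labelSpan k 0 hm (some ⟨0, 0⟩) (2 * k) ⊔ _) ((h3 _).trans h2.symm)
    refine hne (hinj (h1 ⟨_, rfl⟩ ⟨_, rfl⟩ ?_))
    simp only [hj, add_zero]
    exact h4.trans h5.symm
  · rw [fullFlagCode, flagCode_eq_range hm hk hf
      (fun j => by have := j.2; simp only [fullType]; omega), ncard_range_of_injective,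
      card_label hf]
    intro w w' heq
    refine labelSpan_injective hm hk hf le_rfl (t := 1) (by omega) (by omega) ?_
    have := congrFun heq ⟨0, by omega⟩
    simpa [fullType] using this
  -- The row spaces are the components of dimension n - 1, which lies in the range t ≥ 3k + h
  -- because k ≥ 1.
  · rw [subspaceCode_eq_range hm hk hf, ncard_range_of_injective
      (labelSpan_injective hm hk hf (by omega) (by omega) (by omega)), card_label hf]
  · rw [hcode]
    exact ⟨_, ⟨some ⟨0, 0⟩, rfl⟩, _, ⟨some ⟨2, 0⟩, rfl⟩, fun heq => hne (hinj heq),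
      (flagDist_labelSpan_zero hm hk hf).symm⟩
  · rw [hcode]
    rintro _ ⟨_, ⟨w, rfl⟩, _, ⟨w', rfl⟩, hww, rfl⟩
    exact le_flagDist_labelSpan hm hk hf fun heq => hww (by rw [heq])
  · exact (congrArg₂ flagDist (hB 0) (hB 2)).trans (flagDist_labelSpan_zero hm hk hf)
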